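/- Let $A$ be a unital separable $C^*$-algebra whose set $T(A)$ of tracial states is non-empty and whose extreme boundary $\partial T(A)$ is compact in the weak-$*$ topology, let $\alpha$ be a $*$-automorphism of $A$, and let $\omega$ be a free ultrafilter on $\mathbb{N}$. Notation. Put $\|a\|_{2,u}=\sup_{\tau\in T(A)}\tau(a^*a)^{1/2}$ for $a\in A$. Let $A_\omega=\ell^\infty(\mathbb N,A)/\{(a_n)_n:\lim_{n\to\omega}\|a_n\|=0\}$, in which $A$ is represented by constant sequences, let $F(A)=A_\omega\cap A'$ and $\alpha_\omega((a_n)_n)=(\alpha(a_n))_n$, and for $a=(a_n)_n\in A_\omega$ put $\|a\|_{2,\omega}=\lim_{n\to\omega}\|a_n\|_{2,u}$; let $J_A=\{a\in A_\omega:\|a\|_{2,\omega}=0\}$ be the trace-kernel ideal. Let $\mathcal M=\overline{A}^u$ be the uniform 2-norm completion of $A$, i.e. the $C^*$-algebra of norm-bounded $\|\cdot\|_{2,u}$-Cauchy sequences in $A$ modulo the $\|\cdot\|_{2,u}$-null sequences, let $E:\mathcal M\to C(\partial T(A))$ be the continuous extension of $E(a)(\tau)=\tau(a)$ $(a\in A,\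 \tau\in\partial T(A))$, and put $\|x\|_{2,u}=\|E(x^*x)\|^{1/2}$ for $x\in\mathcal M$. Let $\tilde\alpha$ be the automorphism of $\mathcal M$ induced by $\alpha$. Let $\mathcal M^\omega$ be the algebra of norm-bounded sequences $(x_n)_n$ in $\mathcal M$ modulo those with $\lim_{n\to\omega}\|x_n\|_{2,u}=0$, in which $\mathcal M$ is represented by constant sequences, and put $\tilde\alpha_\omega((x_n)_n)=(\tilde\alpha(x_n))_n$ and $\|(x_n)_n\|^{(\omega)}_{2,u}=\lim_{n\to\omega}\|x_n\|_{2,u}$. Suppose that for every integer $n\ge 1$ there exist projections $p_1,\dots,p_n$ in $\mathcal M^\omega\cap\mathcal M'$ such that (i) $\tilde\alpha_\omega(p_k)=p_{k+1}$ for $1\le k\le n$, with indices modulo $n$; (ii) $\sum_{k=1}^n p_k=1$; (iii) $\|1-p_1\|^{(\omega)}_{2,u}<1$. Then $\alpha$ has the approximate Rokhlin property: for every integer $n\ge 1$ there exist positive contractions $f_1,\dots,f_n$ in $F(A)$ such that (i) $\alpha_\omega(f_k)=f_{k+1}$ for $1\le k\le n$, with indices modulo $n$; (ii) $f_kf_\ell=0$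 for $1\le k\ne\ell\le n$; (iii) $1-\sum_{k=1}^n f_k\in J_A\cap F(A)$; (iv) $\sup_{m\in\mathbb N}\|1-f_1^m\|_{2,\omega}<1$. -/

import Mathlib

open Filter Topology
open scoped BoundedContinuousFunction ComplexOrder

set_option linter.unusedSectionVars false

noncomputable section

namespace ApproxRokhlin

/-! ### Quotients of normed `*`-algebras by closed two-sided `*`-ideals -/

section Quotients

variable {R : Type*} [NormedRing R] [NormedAlgebra ℂ R] [StarRing R] [NormedStarGroup R]
  [StarModule ℂ R]

/-- A norm-closed two-sided ideal that is stable under the involution. -/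
class IsClosedStarIdeal (I : Ideal R) : Prop extends I.IsTwoSided where
  star_mem : ∀ {x : R}, x ∈ I → star x ∈ I
  isClosed : IsClosed (I : Set R)

variable (I : Ideal R) [hI : IsClosedStarIdeal I]

/-- The quotient `R ⧸ I` with the quotient norm. -/
instance quotNormedRing : NormedRing (R ⧸ I) :=
  haveI : IsClosed (I : Set R) := hI.isClosed
  { Ideal.Quotient.ring I, Submodule.Quotient.normedAddCommGroup I with
    norm_mul_le := fun x y => by
      refine le_of_forall_pos_le_add fun ε hε => ?_
      have h1 : Tendsto (fun δ : ℝ => (‖x‖ + δ) * (‖y‖ + δ)) (𝓝[>] 0) (𝓝 (‖x‖ * ‖y‖)) := by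
        have : Tendsto (fun δ : ℝ => (‖x‖ + δ) * (‖y‖ + δ)) (𝓝 0)
            (𝓝 ((‖x‖ + 0) * (‖y‖ + 0))) := by
          apply Continuous.tendsto; fun_prop
        rw [add_zero, add_zero] at this
        exact this.mono_left nhdsWithin_le_nhds
      have h2 : ∀ᶠ δ in 𝓝[>] (0 : ℝ), (‖x‖ + δ) * (‖y‖ + δ) < ‖x‖ * ‖y‖ + ε :=
        h1.eventually_lt_const (by linarith)
      obtain ⟨δ, hδ, hδ0⟩ := (h2.and self_mem_nhdsWithin).exists
      obtain ⟨a, rfl, ha⟩ := Submodule.Quotient.norm_mk_lt x hδ0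
      obtain ⟨b, rfl, hb⟩ := Submodule.Quotient.norm_mk_lt y hδ0
      calc _ ≤ ‖a * b‖ := Submodule.Quotient.norm_mk_le I (a * b)
        _ ≤ ‖a‖ * ‖b‖ := norm_mul_le a b
        _ ≤ (‖(Submodule.Quotient.mk a : R ⧸ I)‖ + δ) *
              (‖(Submodule.Quotient.mk b : R ⧸ I)‖ + δ) :=
            mul_le_mul ha.le hb.le (norm_nonneg _)
              (add_nonneg (norm_nonneg _) (le_of_lt hδ0))
        _ ≤ _ := hδ.le }

theorem norm_mk_le (x : R) : ‖Ideal.Quotient.mk I x‖ ≤ ‖x‖ :=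
  Submodule.Quotient.norm_mk_le I x

variable {I} in
theorem exists_norm_mk_lt (x : R ⧸ I) {ε : ℝ} (hε : 0 < ε) :
    ∃ a : R, Ideal.Quotient.mk I a = x ∧ ‖a‖ < ‖x‖ + ε :=
  Submodule.Quotient.norm_mk_lt x hε

instance quotNormedAlgebra : NormedAlgebra ℂ (R ⧸ I) :=
  haveI : IsClosed (I : Set R) := hI.isClosed
  { Submodule.Quotient.normedSpace I ℂ, Ideal.Quotient.algebra ℂ with }

/-- The involution of the quotient: `(x + I)* = x* + I`. -/
instance quotStarRing : StarRing (R ⧸ I) where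
  star := Quotient.lift (fun x : R => Ideal.Quotient.mk I (star x)) fun a b h => by
    have h' : a - b ∈ I := (Submodule.quotientRel_def I).1 h
    refine Ideal.Quotient.eq.2 ?_
    rw [← star_sub]
    exact hI.star_mem h'
  star_involutive x := by
    obtain ⟨a, rfl⟩ := Ideal.Quotient.mk_surjective x
    exact congrArg (Ideal.Quotient.mk I) (star_star a)
  star_mul x y := by
    obtain ⟨a, rfl⟩ := Ideal.Quotient.mk_surjective x
    obtain ⟨b, rfl⟩ := Ideal.Quotient.mk_surjective y
    exact congrArg (Ideal.Quotient.mk I) (star_mul a b)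
  star_add x y := by
    obtain ⟨a, rfl⟩ := Ideal.Quotient.mk_surjective x
    obtain ⟨b, rfl⟩ := Ideal.Quotient.mk_surjective y
    exact congrArg (Ideal.Quotient.mk I) (star_add a b)

theorem star_mk (x : R) : star (Ideal.Quotient.mk I x) = Ideal.Quotient.mk I (star x) := rfl

instance quotNormedStarGroup : NormedStarGroup (R ⧸ I) where
  norm_star_le x := by
    refine le_of_forall_pos_le_add fun ε hε => ?_
    obtain ⟨a, rfl, ha⟩ := exists_norm_mk_lt x hε
    calc ‖star (Ideal.Quotient.mk I a)‖ ≤ ‖star a‖ := norm_mk_le I _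
      _ = ‖a‖ := norm_star a
      _ ≤ _ := ha.le

instance quotStarModule : StarModule ℂ (R ⧸ I) where
  star_smul c x := by
    obtain ⟨a, rfl⟩ := Ideal.Quotient.mk_surjective x
    exact congrArg (Ideal.Quotient.mk I) (star_smul c a)

variable {I}

variable (I) in
/-- The quotient map `R → R ⧸ I`. -/
def quotMk : R →⋆ₐ[ℂ] (R ⧸ I) where
  toFun := Ideal.Quotient.mk I
  map_one' := rfl
  map_mul' _ _ := rfl
  map_zero' := rfl
  map_add' _ _ := rfl
  commutes' _ := rfl
  map_star' _ := rfl

/-- A `*`-automorphism of `R` that leaves `I` invariant descends to `R ⧸ I`. -/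
def quotAut (e : R ≃⋆ₐ[ℂ] R) (he : ∀ x, e x ∈ I ↔ x ∈ I) : (R ⧸ I) ≃⋆ₐ[ℂ] (R ⧸ I) where
  toFun := Quotient.lift (fun x : R => Ideal.Quotient.mk I (e x)) fun a b h => by
    have h' : a - b ∈ I := (Submodule.quotientRel_def I).1 h
    refine Ideal.Quotient.eq.2 ?_
    rw [← map_sub]
    exact (he _).2 h'
  invFun := Quotient.lift (fun x : R => Ideal.Quotient.mk I (e.symm x)) fun a b h => by
    have h' : a - b ∈ I := (Submodule.quotientRel_def I).1 h
    refine Ideal.Quotient.eq.2 ?_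
    rw [← map_sub, ← he, StarAlgEquiv.apply_symm_apply]
    exact h'
  left_inv x := by
    obtain ⟨a, rfl⟩ := Ideal.Quotient.mk_surjective x
    exact congrArg (Ideal.Quotient.mk I) (e.symm_apply_apply a)
  right_inv x := by
    obtain ⟨a, rfl⟩ := Ideal.Quotient.mk_surjective x
    exact congrArg (Ideal.Quotient.mk I) (e.apply_symm_apply a)
  map_mul' x y := by
    obtain ⟨a, rfl⟩ := Ideal.Quotient.mk_surjective x
    obtain ⟨b, rfl⟩ := Ideal.Quotient.mk_surjective y
    exact congrArg (Ideal.Quotient.mk I) (map_mul e a b)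
  map_add' x y := by
    obtain ⟨a, rfl⟩ := Ideal.Quotient.mk_surjective x
    obtain ⟨b, rfl⟩ := Ideal.Quotient.mk_surjective y
    exact congrArg (Ideal.Quotient.mk I) (map_add e a b)
  map_star' x := by
    obtain ⟨a, rfl⟩ := Ideal.Quotient.mk_surjective x
    exact congrArg (Ideal.Quotient.mk I) (map_star e a)
  map_smul' c x := by
    obtain ⟨a, rfl⟩ := Ideal.Quotient.mk_surjective x
    exact congrArg (Ideal.Quotient.mk I) (map_smul e c a)

theorem quotAut_mk (e : R ≃⋆ₐ[ℂ] R) (he : ∀ x, e x ∈ I ↔ x ∈ I) (x : R) :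
    quotAut e he (Ideal.Quotient.mk I x) = Ideal.Quotient.mk I (e x) := rfl

theorem norm_quotAut (e : R ≃⋆ₐ[ℂ] R) (he : ∀ x, e x ∈ I ↔ x ∈ I) (hn : ∀ x, ‖e x‖ = ‖x‖)
    (x : R ⧸ I) : ‖quotAut e he x‖ = ‖x‖ := by
  apply le_antisymm
  · refine le_of_forall_pos_le_add fun ε hε => ?_
    obtain ⟨a, rfl, ha⟩ := exists_norm_mk_lt x hε
    rw [quotAut_mk]
    exact (norm_mk_le I _).trans ((hn a).le.trans ha.le)
  · refine le_of_forall_pos_le_add fun ε hε => ?_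
    obtain ⟨a, ha', ha⟩ := exists_norm_mk_lt (quotAut e he x) hε
    have hx : x = Ideal.Quotient.mk I (e.symm a) := by
      refine (quotAut e he).injective (ha'.symm.trans ?_)
      exact congrArg (Ideal.Quotient.mk I) (e.apply_symm_apply a).symm
    calc ‖x‖ ≤ ‖e.symm a‖ := hx ▸ norm_mk_le I _
      _ = ‖a‖ := by rw [← hn, e.apply_symm_apply]
      _ ≤ _ := ha.le

end Quotients

/-! ### Bounded sequences, null sequences and limits of seminorms -/

section Sequences

variable {B : Type*} [NormedRing B] [NormedAlgebra ℂ B] [StarRing B] [NormedStarGroup B]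
  [StarModule ℂ B]

/-- A `*`-invariant seminorm, dominated by the norm, whose null sequences form an ideal of the
algebra of bounded sequences. -/
structure IdealSeminorm (B : Type*) [NormedRing B] [StarRing B] extends AddGroupSeminorm B where
  map_star' : ∀ x, toFun (star x) = toFun x
  mul_le' : ∀ x y, toFun (x * y) ≤ ‖x‖ * toFun y
  le_norm' : ∀ x, toFun x ≤ ‖x‖

instance : CoeFun (IdealSeminorm B) fun _ => B → ℝ := ⟨fun N => N.toFun⟩

variable (N : IdealSeminorm B)

namespace IdealSeminorm

theorem map_zero : N 0 = 0 := N.map_zero'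
theorem add_le (x y : B) : N (x + y) ≤ N x + N y := N.add_le' x y
theorem map_star (x : B) : N (star x) = N x := N.map_star' x
theorem mul_le (x y : B) : N (x * y) ≤ ‖x‖ * N y := N.mul_le' x y
theorem le_norm (x : B) : N x ≤ ‖x‖ := N.le_norm' x
theorem nonneg (x : B) : 0 ≤ N x := apply_nonneg N.toAddGroupSeminorm x
theorem abs_sub_le (x y : B) : |N x - N y| ≤ N (x - y) :=
  abs_sub_map_le_sub N.toAddGroupSeminorm x y
theorem mul_le_right (x y : B) : N (x * y) ≤ N x * ‖y‖ := by
  rw [← N.map_star, star_mul, ← N.map_star x, mul_comm, ← norm_star y]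
  exact N.mul_le _ _

end IdealSeminorm

/-- The norm itself. -/
def normSeminorm (B : Type*) [NormedRing B] [StarRing B] [NormedStarGroup B] :
    IdealSeminorm B where
  toAddGroupSeminorm := normAddGroupSeminorm B
  map_star' := norm_star
  mul_le' := norm_mul_le
  le_norm' _ := le_rfl

/-- The bounded sequences `(xₙ)` in `B` such that `N xₙ` tends to `0` along `l`, as an ideal of the
algebra `ℓ^∞(ℕ, B)` of all bounded sequences. -/
def nullIdeal (l : Filter ℕ) : Ideal (ℕ →ᵇ B) where
  carrier := {x | Tendsto (fun n => N (x n)) l (𝓝 0)}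
  zero_mem' := tendsto_const_nhds.congr fun _ => N.map_zero.symm
  add_mem' {x y} hx hy := by
    refine squeeze_zero (fun n => N.nonneg _) (fun n => N.add_le (x n) (y n)) ?_
    simpa using Tendsto.add hx hy
  smul_mem' c x hx := by
    refine squeeze_zero (g := fun n => ‖c‖ * N (x n)) (fun n => N.nonneg _) (fun n => ?_) ?_
    · exact (N.mul_le _ _).trans
        (mul_le_mul_of_nonneg_right (c.norm_coe_le_norm n) (N.nonneg _))
    · simpa using Tendsto.const_mul ‖c‖ hx

theorem mem_nullIdeal {l : Filter ℕ} {x : ℕ →ᵇ B} :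
    x ∈ nullIdeal N l ↔ Tendsto (fun n => N (x n)) l (𝓝 0) := Iff.rfl

instance nullIdeal_isClosedStarIdeal (l : Filter ℕ) : IsClosedStarIdeal (nullIdeal N l) where
  mul_mem_of_left {x} c hx := by
    refine squeeze_zero (g := fun n => N (x n) * ‖c‖) (fun n => N.nonneg _) (fun n => ?_) ?_
    · exact (N.mul_le_right _ _).trans
        (mul_le_mul_of_nonneg_left (c.norm_coe_le_norm n) (N.nonneg _))
    · simpa using Tendsto.mul_const ‖c‖ hx
  star_mem {x} hx := by
    rw [mem_nullIdeal] at hx ⊢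
    simpa only [BoundedContinuousFunction.star_apply, N.map_star] using hx
  isClosed := by
    refine isClosed_of_closure_subset fun x hx => ?_
    rw [Metric.mem_closure_iff] at hx
    refine Metric.tendsto_nhds.2 fun ε hε => ?_
    obtain ⟨y, hy, hxy⟩ := hx (ε / 2) (by positivity)
    filter_upwards [Metric.tendsto_nhds.1 hy (ε / 2) (by positivity)] with n hn
    rw [Real.dist_0_eq_abs, abs_of_nonneg (N.nonneg _)] at hn ⊢
    have h1 : N (x n - y n) ≤ dist x y := (N.le_norm _).trans (by
      rw [← dist_eq_norm]; exact BoundedContinuousFunction.dist_coe_le_dist n)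
    have h2 := N.add_le (x n - y n) (y n)
    rw [sub_add_cancel] at h2
    linarith

variable (B) in
/-- The embedding of `B` into the bounded sequences as constant sequences. -/
def constSeq : B →⋆ₐ[ℂ] (ℕ →ᵇ B) where
  toFun b := BoundedContinuousFunction.const ℕ b
  map_one' := rfl
  map_mul' _ _ := rfl
  map_zero' := rfl
  map_add' _ _ := rfl
  commutes' _ := rfl
  map_star' _ := rfl

/-- The automorphism of the algebra of bounded sequences obtained by applying an isometric
`*`-automorphism termwise. -/
def seqAut (e : B ≃⋆ₐ[ℂ] B) (he : ∀ x, ‖e x‖ = ‖x‖) : (ℕ →ᵇ B) ≃⋆ₐ[ℂ] (ℕ →ᵇ B) where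
  toFun x := BoundedContinuousFunction.ofNormedAddCommGroupDiscrete (fun n => e (x n)) ‖x‖
    fun n => (he _).le.trans (x.norm_coe_le_norm n)
  invFun x := BoundedContinuousFunction.ofNormedAddCommGroupDiscrete (fun n => e.symm (x n)) ‖x‖
    fun n => by
      rw [← he, e.apply_symm_apply]; exact x.norm_coe_le_norm n
  left_inv x := by ext n; exact e.symm_apply_apply (x n)
  right_inv x := by ext n; exact e.apply_symm_apply (x n)
  map_mul' x y := by ext n; exact map_mul e (x n) (y n)
  map_add' x y := by ext n; exact map_add e (x n) (y n)
  map_star' x := by ext n; exact map_star e (x n)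
  map_smul' c x := by ext n; exact map_smul e c (x n)

theorem seqAut_apply (e : B ≃⋆ₐ[ℂ] B) (he : ∀ x, ‖e x‖ = ‖x‖) (x : ℕ →ᵇ B) (n : ℕ) :
    seqAut e he x n = e (x n) := rfl

theorem norm_seqAut (e : B ≃⋆ₐ[ℂ] B) (he : ∀ x, ‖e x‖ = ‖x‖) (x : ℕ →ᵇ B) :
    ‖seqAut e he x‖ = ‖x‖ := by
  simp only [BoundedContinuousFunction.norm_eq, seqAut_apply, he]

/-- For a bounded sequence the seminorms converge along every ultrafilter. -/
theorem exists_tendsto_seminorm (ω : Ultrafilter ℕ) (x : ℕ →ᵇ B) :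
    ∃ c, Tendsto (fun n => N (x n)) ω (𝓝 c) := by
  obtain ⟨c, -, hc⟩ := (isCompact_Icc (a := (0 : ℝ)) (b := ‖x‖)).ultrafilter_le_nhds
    (ω.map fun n => N (x n)) (by
      rw [le_principal_iff]
      exact Eventually.of_forall (f := (ω : Filter ℕ)) fun n =>
        ⟨N.nonneg _, (N.le_norm _).trans (x.norm_coe_le_norm n)⟩)
  exact ⟨c, hc⟩

/-- The limit seminorm `lim_{n → ω} N xₙ` of the class of a bounded sequence `(xₙ)`, where the
sequences are taken modulo the null sequences of a seminorm `N₀` that dominates `N`. -/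
def limSeminorm (ω : Ultrafilter ℕ) (N₀ N : IdealSeminorm B) (h : ∀ x, N x ≤ N₀ x) :
    ((ℕ →ᵇ B) ⧸ nullIdeal N₀ ω) → ℝ :=
  Quotient.lift (fun x : ℕ →ᵇ B => limUnder (ω : Filter ℕ) fun n => N (x n)) fun a b hab => by
    have h' : Tendsto (fun n => N₀ (a n - b n)) ω (𝓝 0) :=
      (Submodule.quotientRel_def (nullIdeal N₀ (ω : Filter ℕ))).1 hab
    obtain ⟨c, hc⟩ := exists_tendsto_seminorm N ω a
    have h1 : Tendsto (fun n => N (a n) - N (b n)) ω (𝓝 0) :=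
      squeeze_zero_norm (fun n => (N.abs_sub_le _ _).trans (h _)) h'
    have h2 : Tendsto (fun n => N (b n)) ω (𝓝 c) := by
      simpa using hc.sub h1
    exact hc.limUnder_eq.trans h2.limUnder_eq.symm

theorem tendsto_limSeminorm (ω : Ultrafilter ℕ) (N₀ N : IdealSeminorm B) (h : ∀ x, N x ≤ N₀ x)
    (x : ℕ →ᵇ B) : Tendsto (fun n => N (x n)) ω
      (𝓝 (limSeminorm ω N₀ N h (Ideal.Quotient.mk _ x))) :=
  tendsto_nhds_limUnder (exists_tendsto_seminorm N ω x)

end Sequences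

/-! ### Tracial states and uniform 2-norms -/

section Traces

variable (A : Type*) [CStarAlgebra A]

/-- `T(A)`: the tracial states of `A`, with the weak-`*` topology of the dual space of `A`. -/
def tracialStates : Set (WeakDual ℂ A) :=
  {τ | τ 1 = 1 ∧ (∀ a, 0 ≤ τ (star a * a)) ∧ ∀ a b, τ (a * b) = τ (b * a)}

/-- `∂T(A)`: the extreme points of the convex set `T(A)`. -/
def extremeTraces : Set (WeakDual ℂ A) := Set.extremePoints ℝ (tracialStates A)

theorem extremeTraces_subset : extremeTraces A ⊆ tracialStates A := extremePoints_subset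

variable {A}

/-- `‖a‖_{2,τ} = τ(a* a)^{1/2}`. -/
def traceNorm (τ : WeakDual ℂ A) (a : A) : ℝ := √(τ (star a * a)).re

theorem traceNorm_props {τ : WeakDual ℂ A} (hτ : τ ∈ tracialStates A) :
    (∀ a b, traceNorm τ (a + b) ≤ traceNorm τ a + traceNorm τ b) ∧
    (∀ a b, traceNorm τ (a * b) ≤ ‖a‖ * traceNorm τ b) ∧
    (∀ a, ‖τ a‖ ≤ traceNorm τ a) := by
  let _ := CStarAlgebra.spectralOrder A
  let _ := CStarAlgebra.spectralOrderedRing A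
  let f : A →ₚ[ℂ] ℂ := PositiveLinearMap.mk₀ (τ : A →L[ℂ] ℂ).toLinearMap fun x hx => by
    obtain ⟨y, rfl⟩ := CStarAlgebra.nonneg_iff_eq_star_mul_self.1 hx
    exact hτ.2.1 y
  have hf : ∀ a, traceNorm τ a = ‖f.toPreGNS a‖ := fun a => rfl
  refine ⟨fun a b => ?_, fun a b => ?_, fun a => ?_⟩
  · simp only [hf, _root_.map_add]; exact norm_add_le _ _
  · rw [hf, hf]
    refine (ContinuousLinearMap.le_opNorm (f.leftMulMapPreGNS a) (f.toPreGNS b)).trans ?_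
    exact mul_le_mul_of_nonneg_right (LinearMap.mkContinuous_norm_le _ (norm_nonneg a) _)
      (norm_nonneg _)
  · have h := norm_inner_le_norm (𝕜 := ℂ) (f.toPreGNS 1) (f.toPreGNS a)
    have h1 : ‖f.toPreGNS 1‖ = 1 := by
      rw [← hf]; simp [traceNorm, hτ.1]
    rw [h1, one_mul, PositiveLinearMap.preGNS_inner_def] at h
    rw [hf]
    refine le_of_eq_of_le ?_ h
    show ‖τ a‖ = ‖τ (star 1 * a)‖
    rw [star_one, one_mul]

theorem traceNorm_nonneg (τ : WeakDual ℂ A) (a : A) : 0 ≤ traceNorm τ a := Real.sqrt_nonneg _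

theorem traceNorm_le_norm {τ : WeakDual ℂ A} (hτ : τ ∈ tracialStates A) (a : A) :
    traceNorm τ a ≤ ‖a‖ := by
  have h := (traceNorm_props hτ).2.1 a 1
  have h1 : traceNorm τ (1 : A) = 1 := by simp [traceNorm, hτ.1]
  simpa [h1] using h

theorem bddAbove_traceNorm {X : Set (WeakDual ℂ A)} (hX : X ⊆ tracialStates A) (a : A) :
    BddAbove (Set.range fun τ : X => traceNorm τ.1 a) :=
  ⟨‖a‖, by rintro _ ⟨τ, rfl⟩; exact traceNorm_le_norm (hX τ.2) a⟩

theorem traceNorm_le_iSup {X : Set (WeakDual ℂ A)} (hX : X ⊆ tracialStates A) (a : A)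
    {τ : WeakDual ℂ A} (hτ : τ ∈ X) : traceNorm τ a ≤ ⨆ τ : X, traceNorm τ.1 a :=
  le_ciSup (bddAbove_traceNorm hX a) (⟨τ, hτ⟩ : X)

/-- The seminorm `a ↦ sup_{τ ∈ X} τ(a* a)^{1/2}` for a set `X` of tracial states. -/
def supTraceNorm (X : Set (WeakDual ℂ A)) (hX : X ⊆ tracialStates A) : IdealSeminorm A where
  toFun a := ⨆ τ : X, traceNorm τ.1 a
  map_zero' := by simp [traceNorm]
  add_le' a b := by
    refine Real.iSup_le (fun τ => ((traceNorm_props (hX τ.2)).1 a b).trans ?_)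
      (add_nonneg (Real.iSup_nonneg fun τ => traceNorm_nonneg _ _)
        (Real.iSup_nonneg fun τ => traceNorm_nonneg _ _))
    exact add_le_add (traceNorm_le_iSup hX a τ.2) (traceNorm_le_iSup hX b τ.2)
  neg' a := by simp [traceNorm]
  map_star' a := by
    refine congrArg _ (funext fun τ => ?_)
    rw [traceNorm, traceNorm, star_star, (hX τ.2).2.2]
  mul_le' a b := by
    refine Real.iSup_le (fun τ => ((traceNorm_props (hX τ.2)).2.1 a b).trans ?_)
      (mul_nonneg (norm_nonneg _) (Real.iSup_nonneg fun τ => traceNorm_nonneg _ _))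
    exact mul_le_mul_of_nonneg_left (traceNorm_le_iSup hX b τ.2) (norm_nonneg _)
  le_norm' a := Real.iSup_le (fun τ => traceNorm_le_norm (hX τ.2) a) (norm_nonneg _)

variable (A) in
/-- The uniform 2-norm `‖a‖_{2,u} = sup_{τ ∈ T(A)} τ(a* a)^{1/2}` on `A`. -/
def uniformTwoNorm : IdealSeminorm A := supTraceNorm (tracialStates A) subset_rfl

/-- Precomposition `τ ↦ τ ∘ α` with a `*`-automorphism. -/
def precomp (α : A ≃⋆ₐ[ℂ] A) (τ : WeakDual ℂ A) : WeakDual ℂ A :=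
  StrongDual.toWeakDual ((WeakDual.toStrongDual τ).comp
    (LinearMap.mkContinuous (σ := RingHom.id ℂ) (E := A) (F := A)
      { toFun := fun a => α a, map_add' := map_add α, map_smul' := fun c a => map_smul α c a } 1
      fun a => by
        rw [one_mul]
        exact (NonUnitalStarAlgHom.norm_map α α.injective a).le))

theorem precomp_apply (α : A ≃⋆ₐ[ℂ] A) (τ : WeakDual ℂ A) (a : A) :
    precomp α τ a = τ (α a) := rfl

theorem precomp_mem_tracialStates (α : A ≃⋆ₐ[ℂ] A) {τ : WeakDual ℂ A}
    (hτ : τ ∈ tracialStates A) : precomp α τ ∈ tracialStates A := by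
  refine ⟨?_, fun a => ?_, fun a b => ?_⟩
  · rw [precomp_apply, map_one, hτ.1]
  · rw [precomp_apply, map_mul α, map_star α]; exact hτ.2.1 _
  · rw [precomp_apply, precomp_apply, map_mul α, map_mul α, hτ.2.2]

theorem precomp_precomp_symm (α : A ≃⋆ₐ[ℂ] A) (τ : WeakDual ℂ A) :
    precomp α (precomp α.symm τ) = τ := by
  refine DFunLike.ext _ _ fun a => ?_
  rw [precomp_apply, precomp_apply, α.symm_apply_apply]

theorem precomp_mem_extremeTraces (α : A ≃⋆ₐ[ℂ] A) {τ : WeakDual ℂ A}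
    (hτ : τ ∈ extremeTraces A) : precomp α τ ∈ extremeTraces A := by
  refine ⟨precomp_mem_tracialStates α hτ.1, fun σ₁ h₁ σ₂ h₂ h => ?_⟩
  have key : τ ∈ openSegment ℝ (precomp α.symm σ₁) (precomp α.symm σ₂) := by
    obtain ⟨a, b, ha, hb, hab, h⟩ := h
    refine ⟨a, b, ha, hb, hab, DFunLike.ext _ _ fun x => ?_⟩
    have h' := DFunLike.congr_fun h (α.symm x)
    rw [precomp_apply, α.apply_symm_apply] at h'
    exact h'
  have := hτ.2 (precomp_mem_tracialStates _ h₁) (precomp_mem_tracialStates _ h₂) key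
  rw [← this, precomp_precomp_symm]

theorem supTraceNorm_aut {X : Set (WeakDual ℂ A)} (hX : X ⊆ tracialStates A)
    (hinv : ∀ (α : A ≃⋆ₐ[ℂ] A), ∀ τ ∈ X, precomp α τ ∈ X) (α : A ≃⋆ₐ[ℂ] A) (a : A) :
    supTraceNorm X hX (α a) = supTraceNorm X hX a := by
  have key : ∀ (β : A ≃⋆ₐ[ℂ] A) (b : A), supTraceNorm X hX (β b) ≤ supTraceNorm X hX b := by
    intro β b
    refine Real.iSup_le (fun τ => ?_) ((supTraceNorm X hX).nonneg b)
    have h : traceNorm τ.1 (β b) = traceNorm (precomp β τ.1) b := by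
      rw [traceNorm, traceNorm, precomp_apply, map_mul β, map_star β]
    rw [h]
    exact traceNorm_le_iSup hX b (hinv β τ.1 τ.2)
  refine le_antisymm (key α a) ?_
  have := key α.symm (α a)
  rwa [α.symm_apply_apply] at this

theorem uniformTwoNorm_aut (α : A ≃⋆ₐ[ℂ] A) (a : A) :
    uniformTwoNorm A (α a) = uniformTwoNorm A a :=
  supTraceNorm_aut _ (fun α _ => precomp_mem_tracialStates α) α a

theorem norm_aut (α : A ≃⋆ₐ[ℂ] A) (a : A) : ‖α a‖ = ‖a‖ :=
  NonUnitalStarAlgHom.norm_map α α.injective a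

end Traces

/-! ### The uniform 2-norm completion `M` of `A` as a bundle over `∂T(A)` -/

section Completion

variable (A : Type*) [CStarAlgebra A]

/-- The norm-bounded sequences in `A` that are Cauchy in the uniform 2-norm. -/
def cauchySeqs : StarSubalgebra ℂ (ℕ →ᵇ A) where
  carrier := {x | ∀ ε > 0, ∃ k, ∀ m ≥ k, ∀ n ≥ k, uniformTwoNorm A (x m - x n) < ε}
  mul_mem' {x y} hx hy ε hε := by
    set C := ‖x‖ + ‖y‖ + 1 with hC
    have hC0 : 0 < C := by positivity
    obtain ⟨k, hk⟩ := hx (ε / (2 * C)) (by positivity)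
    obtain ⟨l, hl⟩ := hy (ε / (2 * C)) (by positivity)
    refine ⟨max k l, fun m hm n hn => ?_⟩
    have h1 := hk m (le_of_max_le_left hm) n (le_of_max_le_left hn)
    have h2 := hl m (le_of_max_le_right hm) n (le_of_max_le_right hn)
    have hxm : ‖x m‖ ≤ C := (x.norm_coe_le_norm m).trans (by
      have := norm_nonneg y; linarith)
    have hyn : ‖y n‖ ≤ C := (y.norm_coe_le_norm n).trans (by
      have := norm_nonneg x; linarith)
    have e : (x * y) m - (x * y) n = x m * (y m - y n) + (x m - x n) * y n := by
      simp only [BoundedContinuousFunction.coe_mul, Pi.mul_apply]; noncomm_ring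
    rw [e]
    have h3 := (uniformTwoNorm A).mul_le (x m) (y m - y n)
    have h4 := (uniformTwoNorm A).mul_le_right (x m - x n) (y n)
    have h5 : ‖x m‖ * uniformTwoNorm A (y m - y n) ≤ C * uniformTwoNorm A (y m - y n) :=
      mul_le_mul_of_nonneg_right hxm ((uniformTwoNorm A).nonneg _)
    have h6 : uniformTwoNorm A (x m - x n) * ‖y n‖ ≤ uniformTwoNorm A (x m - x n) * C :=
      mul_le_mul_of_nonneg_left hyn ((uniformTwoNorm A).nonneg _)
    have h7 := mul_lt_mul_of_pos_left h1 hC0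
    have h8 := mul_lt_mul_of_pos_left h2 hC0
    have h9 : C * (ε / (2 * C)) = ε / 2 := by field_simp
    have h10 := (uniformTwoNorm A).add_le (x m * (y m - y n)) ((x m - x n) * y n)
    rw [h9] at h7 h8
    linarith
  add_mem' {x y} hx hy ε hε := by
    obtain ⟨k, hk⟩ := hx (ε / 2) (by positivity)
    obtain ⟨l, hl⟩ := hy (ε / 2) (by positivity)
    refine ⟨max k l, fun m hm n hn => ?_⟩
    have h1 := hk m (le_of_max_le_left hm) n (le_of_max_le_left hn)
    have h2 := hl m (le_of_max_le_right hm) n (le_of_max_le_right hn)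
    have e : (x + y) m - (x + y) n = (x m - x n) + (y m - y n) := by
      simp only [BoundedContinuousFunction.coe_add, Pi.add_apply]; abel
    rw [e]
    have := (uniformTwoNorm A).add_le (x m - x n) (y m - y n)
    linarith
  algebraMap_mem' c ε hε := ⟨0, fun m _ n _ => by
    have : (algebraMap ℂ (ℕ →ᵇ A) c) m - (algebraMap ℂ (ℕ →ᵇ A) c) n = 0 := sub_self _
    rw [this, (uniformTwoNorm A).map_zero]
    exact hε⟩
  star_mem' {x} hx ε hε := by
    obtain ⟨k, hk⟩ := hx ε hε
    refine ⟨k, fun m hm n hn => ?_⟩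
    rw [BoundedContinuousFunction.star_apply, BoundedContinuousFunction.star_apply, ← star_sub,
      (uniformTwoNorm A).map_star]
    exact hk m hm n hn

theorem mem_cauchySeqs {x : ℕ →ᵇ A} : x ∈ cauchySeqs A ↔
    ∀ ε > 0, ∃ k, ∀ m ≥ k, ∀ n ≥ k, uniformTwoNorm A (x m - x n) < ε := Iff.rfl

instance : NormedStarGroup (cauchySeqs A) := ⟨fun x => (norm_star (x : ℕ →ᵇ A)).le⟩

/-- The ideal of uniform 2-norm null sequences in the algebra of norm-bounded uniform 2-norm Cauchy
sequences. -/
def nullCauchySeqs : Ideal (cauchySeqs A) :=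
  (nullIdeal (uniformTwoNorm A) atTop).comap (cauchySeqs A).subtype

theorem mem_nullCauchySeqs {x : cauchySeqs A} :
    x ∈ nullCauchySeqs A ↔ Tendsto (fun n => uniformTwoNorm A (x.1 n)) atTop (𝓝 0) := Iff.rfl

instance : IsClosedStarIdeal (nullCauchySeqs A) where
  mul_mem_of_left {_} c hx :=
    (nullIdeal (uniformTwoNorm A) atTop).mul_mem_right (c : ℕ →ᵇ A) hx
  star_mem {x} hx :=
    (nullIdeal_isClosedStarIdeal (uniformTwoNorm A) atTop).star_mem (x := (x : ℕ →ᵇ A)) hx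
  isClosed :=
    (nullIdeal_isClosedStarIdeal (uniformTwoNorm A) atTop).isClosed.preimage continuous_subtype_val

/-- `M`: the uniform 2-norm completion of `A`, with its quotient norm. -/
def Completion := cauchySeqs A ⧸ nullCauchySeqs A

instance : NormedRing (Completion A) :=
  inferInstanceAs (NormedRing (cauchySeqs A ⧸ nullCauchySeqs A))
instance : StarRing (Completion A) :=
  inferInstanceAs (StarRing (cauchySeqs A ⧸ nullCauchySeqs A))
instance : NormedAlgebra ℂ (Completion A) :=
  inferInstanceAs (NormedAlgebra ℂ (cauchySeqs A ⧸ nullCauchySeqs A))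
instance : NormedStarGroup (Completion A) :=
  quotNormedStarGroup (nullCauchySeqs A)
instance : StarModule ℂ (Completion A) :=
  quotStarModule (nullCauchySeqs A)

variable {A} in
/-- The class in `M` of a Cauchy sequence. -/
def Completion.mk : cauchySeqs A →⋆ₐ[ℂ] Completion A := quotMk (nullCauchySeqs A)

variable {A} in
theorem Completion.mk_surjective : Function.Surjective (Completion.mk (A := A)) :=
  Ideal.Quotient.mk_surjective

variable {A} in
theorem Completion.exists_norm_mk_lt (x : Completion A) {ε : ℝ} (hε : 0 < ε) :
    ∃ a : cauchySeqs A, Completion.mk a = x ∧ ‖a‖ < ‖x‖ + ε :=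
  ApproxRokhlin.exists_norm_mk_lt (I := nullCauchySeqs A) x hε

variable {A}

/-- The function `τ ↦ τ(a)` on `∂T(A)`. When `∂T(A)` is compact, `∂T(A) →ᵇ ℂ` is `C(∂T(A))` with
the supremum norm. -/
def traceEval (a : A) : extremeTraces A →ᵇ ℂ :=
  BoundedContinuousFunction.ofNormedAddCommGroup (fun τ => τ.1 a)
    ((WeakDual.eval_continuous a).comp continuous_subtype_val) ‖a‖ fun τ =>
      ((traceNorm_props τ.2.1).2.2 a).trans (traceNorm_le_norm τ.2.1 a)

theorem traceEval_apply (a : A) (τ : extremeTraces A) : traceEval a τ = τ.1 a := rfl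

theorem traceEval_add (a b : A) : traceEval (a + b) = traceEval a + traceEval b := by
  ext τ; exact map_add τ.1 a b

theorem traceEval_sub (a b : A) : traceEval (a - b) = traceEval a - traceEval b := by
  ext τ; exact map_sub τ.1 a b

theorem traceEval_smul (c : ℂ) (a : A) : traceEval (c • a) = c • traceEval a := by
  ext τ; exact map_smul τ.1 c a

theorem norm_traceEval_le (a : A) : ‖traceEval a‖ ≤ uniformTwoNorm A a := by
  refine (BoundedContinuousFunction.norm_le ((uniformTwoNorm A).nonneg a)).2 fun τ => ?_
  exact ((traceNorm_props τ.2.1).2.2 a).trans (traceNorm_le_iSup subset_rfl a τ.2.1)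

theorem exists_tendsto_traceEval (x : cauchySeqs A) :
    ∃ f, Tendsto (fun n => traceEval (x.1 n)) atTop (𝓝 f) := by
  refine cauchySeq_tendsto_of_complete (Metric.cauchySeq_iff.2 fun ε hε => ?_)
  obtain ⟨k, hk⟩ := x.2 ε hε
  refine ⟨k, fun m hm n hn => ?_⟩
  rw [dist_eq_norm, ← traceEval_sub]
  exact (norm_traceEval_le _).trans_lt (hk m hm n hn)

variable (A) in
/-- The conditional expectation `E : M → C(∂T(A))`, the continuous extension of
`E(a)(τ) = τ(a)` for `a ∈ A`: on the class of a Cauchy sequence `(aₙ)` it is the uniform limit of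
the functions `τ ↦ τ(aₙ)`. -/
def condExp : Completion A → (extremeTraces A →ᵇ ℂ) :=
  Quotient.lift (fun x : cauchySeqs A => limUnder atTop fun n => traceEval (x.1 n))
    fun x y hxy => by
      have h' : Tendsto (fun n => uniformTwoNorm A (x.1 n - y.1 n)) atTop (𝓝 0) :=
        (Submodule.quotientRel_def (nullCauchySeqs A)).1 hxy
      obtain ⟨f, hf⟩ := exists_tendsto_traceEval x
      have h1 : Tendsto (fun n => traceEval (x.1 n) - traceEval (y.1 n)) atTop (𝓝 0) :=
        squeeze_zero_norm (fun n => by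
          rw [← traceEval_sub]; exact norm_traceEval_le _) h'
      have h2 : Tendsto (fun n => traceEval (y.1 n)) atTop (𝓝 f) := by
        simpa using hf.sub h1
      exact hf.limUnder_eq.trans h2.limUnder_eq.symm

theorem tendsto_condExp (x : cauchySeqs A) :
    Tendsto (fun n => traceEval (x.1 n)) atTop (𝓝 (condExp A (Completion.mk x))) :=
  tendsto_nhds_limUnder (exists_tendsto_traceEval x)

variable (A) in
/-- `a ↦ sup_{τ ∈ ∂T(A)} τ(a* a)^{1/2}`. -/
def extremeTwoNorm : IdealSeminorm A := supTraceNorm (extremeTraces A) (extremeTraces_subset A)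

theorem sqrt_norm_traceEval (a : A) : √‖traceEval (star a * a)‖ = extremeTwoNorm A a := by
  have h0 : ∀ τ : extremeTraces A, ‖traceEval (star a * a) τ‖ = traceNorm τ.1 a ^ 2 := by
    intro τ
    have h := τ.2.1.2.1 a
    rw [traceNorm, Real.sq_sqrt (Complex.nonneg_iff.1 h).1, traceEval_apply]
    have h2 := RCLike.norm_of_nonneg' h
    exact congrArg Complex.re h2
  apply le_antisymm
  · refine Real.sqrt_le_iff.2 ⟨(extremeTwoNorm A).nonneg a, ?_⟩
    refine (BoundedContinuousFunction.norm_le (sq_nonneg _)).2 fun τ => ?_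
    rw [h0]
    exact pow_le_pow_left₀ (traceNorm_nonneg _ _)
      (traceNorm_le_iSup (extremeTraces_subset A) a τ.2) 2
  · refine Real.iSup_le (fun τ => Real.le_sqrt_of_sq_le ?_) (Real.sqrt_nonneg _)
    rw [← h0]
    exact (traceEval (star a * a)).norm_coe_le_norm τ

theorem tendsto_bundleNorm (x : cauchySeqs A) :
    Tendsto (fun n => extremeTwoNorm A (x.1 n)) atTop
      (𝓝 √‖condExp A (star (Completion.mk x) *
        Completion.mk x)‖) := by
  have h := (tendsto_condExp (star x * x)).norm.sqrt
  refine h.congr fun n => ?_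
  exact sqrt_norm_traceEval (x.1 n)

variable (A) in
/-- The uniform 2-norm `‖x‖_{2,u} = ‖E(x* x)‖^{1/2}` of the bundle `(M, ∂T(A), E)`. -/
def bundleTwoNorm : IdealSeminorm (Completion A) where
  toFun x := √‖condExp A (star x * x)‖
  map_zero' := by
    have h := tendsto_bundleNorm (0 : cauchySeqs A)
    refine tendsto_nhds_unique h (tendsto_const_nhds.congr fun _ => ?_)
    exact (extremeTwoNorm A).map_zero.symm
  add_le' x y := by
    obtain ⟨a, rfl⟩ := Completion.mk_surjective x
    obtain ⟨b, rfl⟩ := Completion.mk_surjective y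
    exact le_of_tendsto_of_tendsto' (tendsto_bundleNorm (a + b))
      ((tendsto_bundleNorm a).add (tendsto_bundleNorm b))
      fun n => (extremeTwoNorm A).add_le _ _
  neg' x := by rw [star_neg, neg_mul_neg]
  map_star' x := by
    obtain ⟨a, rfl⟩ := Completion.mk_surjective x
    exact tendsto_nhds_unique (tendsto_bundleNorm (star a))
      ((tendsto_bundleNorm a).congr fun n => ((extremeTwoNorm A).map_star _).symm)
  mul_le' x y := by
    obtain ⟨b, rfl⟩ := Completion.mk_surjective y
    refine ge_of_tendsto (x := 𝓝[>] (0 : ℝ)) (f := fun ε => (‖x‖ + ε) *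
      √‖condExp A (star (Completion.mk b) * Completion.mk b)‖) ?_ ?_
    · have : Tendsto (fun ε : ℝ => (‖x‖ + ε) * √‖condExp A
          (star (Completion.mk b) *
            Completion.mk b)‖) (𝓝 0) (𝓝 ((‖x‖ + 0) * √‖condExp A
          (star (Completion.mk b) * Completion.mk b)‖)) := by
        apply Continuous.tendsto; fun_prop
      rw [add_zero] at this
      exact this.mono_left nhdsWithin_le_nhds
    · filter_upwards [self_mem_nhdsWithin] with ε hε
      obtain ⟨a, rfl, ha⟩ := Completion.exists_norm_mk_lt x hε
      refine le_of_tendsto_of_tendsto' (tendsto_bundleNorm (a * b))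
        ((tendsto_bundleNorm b).const_mul _) fun n => ?_
      refine ((extremeTwoNorm A).mul_le _ _).trans
        (mul_le_mul_of_nonneg_right ?_ ((extremeTwoNorm A).nonneg _))
      exact (a.1.norm_coe_le_norm n).trans ha.le
  le_norm' x := by
    refine le_of_forall_pos_le_add fun ε hε => ?_
    obtain ⟨a, rfl, ha⟩ := Completion.exists_norm_mk_lt x hε
    refine le_of_tendsto' (tendsto_bundleNorm a) fun n => ?_
    exact ((extremeTwoNorm A).le_norm _).trans ((a.1.norm_coe_le_norm n).trans ha.le)

theorem tendsto_bundleTwoNorm (x : cauchySeqs A) :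
    Tendsto (fun n => extremeTwoNorm A (x.1 n)) atTop
      (𝓝 (bundleTwoNorm A (Completion.mk x))) := tendsto_bundleNorm x

/-- The automorphism of the algebra of Cauchy sequences obtained by applying `α` termwise. -/
def cauchyAut (α : A ≃⋆ₐ[ℂ] A) : cauchySeqs A ≃⋆ₐ[ℂ] cauchySeqs A where
  toFun x := ⟨seqAut α (norm_aut α) x.1, fun ε hε => by
    obtain ⟨k, hk⟩ := x.2 ε hε
    refine ⟨k, fun m hm n hn => ?_⟩
    rw [seqAut_apply, seqAut_apply, ← map_sub, uniformTwoNorm_aut]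
    exact hk m hm n hn⟩
  invFun x := ⟨(seqAut α (norm_aut α)).symm x.1, fun ε hε => by
    obtain ⟨k, hk⟩ := x.2 ε hε
    refine ⟨k, fun m hm n hn => ?_⟩
    have h : ∀ j, (seqAut α (norm_aut α)).symm x.1 j = α.symm (x.1 j) := fun _ => rfl
    rw [h, h, ← map_sub, uniformTwoNorm_aut]
    exact hk m hm n hn⟩
  left_inv x := Subtype.ext ((seqAut α (norm_aut α)).symm_apply_apply x.1)
  right_inv x := Subtype.ext ((seqAut α (norm_aut α)).apply_symm_apply x.1)
  map_mul' x y := Subtype.ext (map_mul (seqAut α (norm_aut α)) x.1 y.1)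
  map_add' x y := Subtype.ext (map_add (seqAut α (norm_aut α)) x.1 y.1)
  map_star' x := Subtype.ext (map_star (seqAut α (norm_aut α)) x.1)
  map_smul' c x := Subtype.ext (map_smul (seqAut α (norm_aut α)) c x.1)

theorem cauchyAut_apply (α : A ≃⋆ₐ[ℂ] A) (x : cauchySeqs A) (n : ℕ) :
    (cauchyAut α x).1 n = α (x.1 n) := rfl

theorem cauchyAut_mem_iff (α : A ≃⋆ₐ[ℂ] A) (x : cauchySeqs A) :
    cauchyAut α x ∈ nullCauchySeqs A ↔ x ∈ nullCauchySeqs A := by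
  simp only [mem_nullCauchySeqs, cauchyAut_apply, uniformTwoNorm_aut]

theorem norm_cauchyAut (α : A ≃⋆ₐ[ℂ] A) (x : cauchySeqs A) : ‖cauchyAut α x‖ = ‖x‖ :=
  norm_seqAut α (norm_aut α) x.1

/-- The canonical extension `α̃` of `α` to `M`. -/
def extendAut (α : A ≃⋆ₐ[ℂ] A) : Completion A ≃⋆ₐ[ℂ] Completion A :=
  quotAut (I := nullCauchySeqs A) (cauchyAut α) (cauchyAut_mem_iff α)

theorem norm_extendAut (α : A ≃⋆ₐ[ℂ] A) (x : Completion A) : ‖extendAut α x‖ = ‖x‖ :=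
  norm_quotAut (I := nullCauchySeqs A) (cauchyAut α) (cauchyAut_mem_iff α)
    (norm_cauchyAut α) x

theorem bundleTwoNorm_extendAut (α : A ≃⋆ₐ[ℂ] A) (x : Completion A) :
    bundleTwoNorm A (extendAut α x) = bundleTwoNorm A x := by
  obtain ⟨a, rfl⟩ := Completion.mk_surjective x
  refine tendsto_nhds_unique (tendsto_bundleTwoNorm (cauchyAut α a))
    ((tendsto_bundleTwoNorm a).congr fun n => ?_)
  exact (supTraceNorm_aut _ (fun α _ => precomp_mem_extremeTraces α) α _).symm

end Completion

/-! ### Central sequence algebras -/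

section Central

variable (A : Type*) [CStarAlgebra A] (ω : Ultrafilter ℕ)

/-- The ultrapower `A_ω = ℓ^∞(ℕ, A) / c_ω(A)`. -/
def Ultrapower := (ℕ →ᵇ A) ⧸ nullIdeal (normSeminorm A) (ω : Filter ℕ)

instance : NormedRing (Ultrapower A ω) :=
  inferInstanceAs (NormedRing ((ℕ →ᵇ A) ⧸ nullIdeal (normSeminorm A) (ω : Filter ℕ)))
instance : StarRing (Ultrapower A ω) :=
  inferInstanceAs (StarRing ((ℕ →ᵇ A) ⧸ nullIdeal (normSeminorm A) (ω : Filter ℕ)))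
instance : NormedAlgebra ℂ (Ultrapower A ω) :=
  inferInstanceAs (NormedAlgebra ℂ ((ℕ →ᵇ A) ⧸ nullIdeal (normSeminorm A) (ω : Filter ℕ)))
instance : NormedStarGroup (Ultrapower A ω) :=
  quotNormedStarGroup (nullIdeal (normSeminorm A) (ω : Filter ℕ))
instance : StarModule ℂ (Ultrapower A ω) :=
  quotStarModule (nullIdeal (normSeminorm A) (ω : Filter ℕ))

variable {A} in
/-- The class in `A_ω` of a bounded sequence. -/
def Ultrapower.mk : (ℕ →ᵇ A) →⋆ₐ[ℂ] Ultrapower A ω :=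
  quotMk (nullIdeal (normSeminorm A) (ω : Filter ℕ))

/-- The embedding of `A` into `A_ω` as constant sequences. -/
def toUltrapower : A →⋆ₐ[ℂ] Ultrapower A ω := (Ultrapower.mk ω).comp (constSeq A)

/-- `F(A) = A_ω ∩ A'`. -/
def centralSeqAlgebra : StarSubalgebra ℂ (Ultrapower A ω) :=
  StarSubalgebra.centralizer ℂ (Set.range (toUltrapower A ω))

variable {A} in
/-- The automorphism `α_ω` of `A_ω`, `(aₙ) ↦ (α(aₙ))`. -/
def ultrapowerAut (α : A ≃⋆ₐ[ℂ] A) : Ultrapower A ω ≃⋆ₐ[ℂ] Ultrapower A ω :=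
  quotAut (I := nullIdeal (normSeminorm A) (ω : Filter ℕ)) (seqAut α (norm_aut α)) fun x => by
    simp only [mem_nullIdeal, seqAut_apply]
    exact iff_of_eq (congrArg (fun f => Tendsto f _ _) (funext fun n => norm_aut α (x n)))

/-- `‖a‖_{2,ω} = lim_{n → ω} sup_{τ ∈ T(A)} τ(aₙ* aₙ)^{1/2}` for `a = (aₙ) ∈ A_ω`. -/
def ultrapowerTwoNorm : Ultrapower A ω → ℝ :=
  limSeminorm ω (normSeminorm A) (uniformTwoNorm A) (uniformTwoNorm A).le_norm

/-- The trace-kernel ideal `J_A` of `A_ω`. -/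
def traceKernel : Set (Ultrapower A ω) := {a | ultrapowerTwoNorm A ω a = 0}

/-- The ultrapower `M^ω` of the bundle `M`: norm-bounded sequences in `M` modulo the sequences whose
uniform 2-norms tend to `0` along `ω`. -/
def BundleUltrapower := (ℕ →ᵇ Completion A) ⧸ nullIdeal (bundleTwoNorm A) (ω : Filter ℕ)

instance : NormedRing (BundleUltrapower A ω) :=
  inferInstanceAs (NormedRing ((ℕ →ᵇ Completion A) ⧸ nullIdeal (bundleTwoNorm A) (ω : Filter ℕ)))
instance : StarRing (BundleUltrapower A ω) :=
  inferInstanceAs (StarRing ((ℕ →ᵇ Completion A) ⧸ nullIdeal (bundleTwoNorm A) (ω : Filter ℕ)))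
instance : NormedAlgebra ℂ (BundleUltrapower A ω) :=
  inferInstanceAs (NormedAlgebra ℂ ((ℕ →ᵇ Completion A) ⧸ nullIdeal (bundleTwoNorm A) (ω : Filter ℕ)))
instance : NormedStarGroup (BundleUltrapower A ω) :=
  quotNormedStarGroup (nullIdeal (bundleTwoNorm A) (ω : Filter ℕ))
instance : StarModule ℂ (BundleUltrapower A ω) :=
  quotStarModule (nullIdeal (bundleTwoNorm A) (ω : Filter ℕ))

variable {A} in
/-- The class in `M^ω` of a bounded sequence. -/
def BundleUltrapower.mk : (ℕ →ᵇ Completion A) →⋆ₐ[ℂ] BundleUltrapower A ω :=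
  quotMk (nullIdeal (bundleTwoNorm A) (ω : Filter ℕ))

/-- The embedding of `M` into `M^ω` as constant sequences. -/
def toBundleUltrapower : Completion A →⋆ₐ[ℂ] BundleUltrapower A ω :=
  (BundleUltrapower.mk ω).comp (constSeq (Completion A))

/-- `M^ω ∩ M'`. -/
def bundleCentralSeqAlgebra : StarSubalgebra ℂ (BundleUltrapower A ω) :=
  StarSubalgebra.centralizer ℂ (Set.range (toBundleUltrapower A ω))

/-- `‖x‖_{2,u}^{(ω)} = lim_{n → ω} ‖xₙ‖_{2,u}` for `x = (xₙ) ∈ M^ω`. -/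
def bundleUltrapowerTwoNorm : BundleUltrapower A ω → ℝ :=
  limSeminorm ω (bundleTwoNorm A) (bundleTwoNorm A) fun _ => le_rfl

variable {A}

/-- The automorphism `α̃_ω` of `M^ω`, `(xₙ) ↦ (α̃(xₙ))`. -/
def bundleUltrapowerAut (α : A ≃⋆ₐ[ℂ] A) : BundleUltrapower A ω ≃⋆ₐ[ℂ] BundleUltrapower A ω :=
  quotAut (I := nullIdeal (bundleTwoNorm A) (ω : Filter ℕ))
      (seqAut (extendAut α) (norm_extendAut α)) fun x => by
    simp only [mem_nullIdeal, seqAut_apply, bundleTwoNorm_extendAut]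

/-- The Rokhlin property of the extension of `α` to the bundle `M`: for every `n ≥ 1` there is a
cyclic tower of `n` projections in `M^ω ∩ M'`. The indices `1, …, n` are the elements of `Fin n`,
with addition modulo `n`. -/
def BundleRokhlinProperty (α : A ≃⋆ₐ[ℂ] A) : Prop :=
  ∀ (n : ℕ) [NeZero n], ∃ p : Fin n → BundleUltrapower A ω,
    (∀ k, p k ∈ bundleCentralSeqAlgebra A ω ∧ IsStarProjection (p k)) ∧
    (∀ k, bundleUltrapowerAut ω α (p k) = p (k + 1)) ∧
    ∑ k, p k = 1 ∧
    bundleUltrapowerTwoNorm A ω (1 - p 0) < 1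

/-- The approximate Rokhlin property of `α`: for every `n ≥ 1` there is a cyclic tower of `n`
mutually orthogonal positive contractions in `F(A)` with sum `1` modulo the trace-kernel ideal. -/
def ApproximateRokhlinProperty (α : A ≃⋆ₐ[ℂ] A) : Prop :=
  ∀ (n : ℕ) [NeZero n], ∃ f : Fin n → Ultrapower A ω,
    (∀ k, f k ∈ centralSeqAlgebra A ω ∧ (∃ g, f k = star g * g) ∧ ‖f k‖ ≤ 1) ∧
    (∀ k, ultrapowerAut ω α (f k) = f (k + 1)) ∧
    (∀ k l, k ≠ l → f k * f l = 0) ∧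
    1 - ∑ k, f k ∈ traceKernel A ω ∩ centralSeqAlgebra A ω ∧
    ∃ c < 1, ∀ m : ℕ, ultrapowerTwoNorm A ω (1 - f 0 ^ m) ≤ c

end Central

end ApproxRokhlin

end

noncomputable section

namespace ApproxRokhlin

/-! ### Quasicentral approximate units -/

section Quasicentral

variable {R : Type*} [CStarAlgebra R] [PartialOrder R] [StarOrderedRing R]

-- The point is that $\mathcal M^\omega$ is already a quotient of $\ell^\infty(\mathbb N,A)$: the
-- termwise map `seqToBundle` is onto because each element of $\mathcal M$ is a 2-norm limit of a
-- bounded sequence from $A$, and by Krein-Milman its kernel is the ideal $J$ of sequences that are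
-- 2-norm null along $\omega$ (`seqToBundle_surjective`, `seqToBundle_eq_zero_iff`). A Rokhlin tower
-- of projections therefore lifts to positive contractions $z_k$ in $\ell^\infty(\mathbb N,A)$
-- (`exists_contraction_lift`). These satisfy all the relations modulo $J$; orthogonality follows
-- from $\sum_k p_k=1$ (`projections_orthogonal`).
--
-- To turn relations modulo $J$ into relations in norm, choose $e\in J$ that is almost a unit for
-- the finitely many defects of the relations, almost commutes with the relevant elements and is
-- almost fixed by the automorphism (`exists_quasicentral_invariant`). With $d=1-e$, the elements
-- $f_k=dz_kd$ still lift $p_k$, and cutting down by $d$ makes every defect small in norm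
-- (`exists_approximate_tower`). Such an $e$ is obtained by two averagings: of successive almost
-- units, for quasicentrality, and of the iterates under the automorphism, for invariance.
--
-- Conditions (iii) and (iv) survive because they depend only on the image in $\mathcal M^\omega$:
-- $\sum_k f_k$ lifts $1$, and every power $f_1^m$ with $m\ge 1$ lifts the projection $p_1$, so one
-- bound $c<1$ serves all $m$. Evaluating at a good coordinate gives towers in $A$ with arbitrarily
-- small errors (`exists_tower_of_projections`); a diagonal sequence of these satisfies the
-- relations exactly in $A_\omega$.

theorem norm_le_one_of_nonneg_of_le_one {e : R} (h0 : 0 ≤ e) (h1 : e ≤ 1) : ‖e‖ ≤ 1 :=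
  (CStarAlgebra.norm_le_one_iff_of_nonneg e h0).2 h1

theorem norm_one_sub_le_one {e : R} (h0 : 0 ≤ e) (h1 : e ≤ 1) : ‖1 - e‖ ≤ 1 :=
  norm_le_one_of_nonneg_of_le_one (sub_nonneg.2 h1) (sub_le_self _ h0)

/-- A two-sided ideal contains positive contractions that are almost units for a given finite
subset. -/
theorem exists_almost_unit (J : Ideal R) [J.IsTwoSided] {S : Set R} (hS : S.Finite)
    (hSJ : ∀ s ∈ S, s ∈ J) {η : ℝ} (hη : 0 < η) :
    ∃ e ∈ J, 0 ≤ e ∧ e ≤ 1 ∧ ∀ s ∈ S, ‖(1 - e) * s‖ ≤ η := by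
  -- The almost unit is $e=h(h+\delta)^{-1}$. It has $h$ as a factor, so it lies in $J$ without $J$
  -- being closed. Since $ss^*\le h$,
  -- $\|(1-e)s\|^2\le\|(1-e)h(1-e)\|\le\sup_{t\ge0}\delta^2t/(t+\delta)^2\le\delta$, whence the
  -- choice $\delta=\eta^2$.
  set h : R := ∑ s ∈ hS.toFinset, s * star s with hh
  have hJ : h ∈ J := J.sum_mem fun s hs => J.mul_mem_right _ (hSJ s (hS.mem_toFinset.1 hs))
  have h0 : 0 ≤ h := Finset.sum_nonneg fun s _ => mul_star_self_nonneg s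
  have hsa : IsSelfAdjoint h := h0.isSelfAdjoint
  set δ := η ^ 2 with hδ
  have hδ0 : 0 < δ := by positivity
  have hspec : ∀ t ∈ spectrum ℝ h, 0 ≤ t := fun t ht => spectrum_nonneg_of_nonneg h0 ht
  have hc : ContinuousOn (fun t : ℝ => (t + δ)⁻¹) (spectrum ℝ h) := by
    refine ContinuousOn.inv₀ (by fun_prop) fun t ht => ?_
    have := hspec t ht
    positivity
  set w := cfc (fun t : ℝ => (t + δ)⁻¹) h with hw
  have he : cfc (fun t : ℝ => (t + δ)⁻¹ * t) h = w * h := by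
    rw [cfc_mul _ _ h hc (by fun_prop), cfc_id' ℝ h]
  have h1e : 1 - w * h = cfc (fun t : ℝ => δ * (t + δ)⁻¹) h := by
    rw [← he, ← cfc_const_one ℝ h,
      ← cfc_sub (fun _ : ℝ => (1 : ℝ)) (fun t : ℝ => (t + δ)⁻¹ * t) h (by fun_prop)
        (hc.mul (g := fun t => t) (by fun_prop))]
    refine cfc_congr fun t ht => ?_
    have := hspec t ht
    field_simp
    ring
  refine ⟨w * h, J.mul_mem_left _ hJ, ?_, ?_, fun s hs => ?_⟩
  · rw [← he]
    exact cfc_nonneg fun t ht => by have := hspec t ht; positivity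
  · rw [← sub_nonneg, h1e]
    exact cfc_nonneg fun t ht => by have := hspec t ht; positivity
  · set d := 1 - w * h with hd
    have hdsa : star d = d := by
      rw [h1e]; exact cfc_predicate (fun t : ℝ => δ * (t + δ)⁻¹) h
    have hle : s * star s ≤ h :=
      Finset.single_le_sum (f := fun s : R => s * star s) (fun s _ => mul_star_self_nonneg s)
        (hS.mem_toFinset.2 hs)
    have h2 : d * (s * star s) * star d ≤ d * h * star d := star_right_conjugate_le_conjugate hle d
    have h3 : d * h * star d = cfc (fun t : ℝ => δ * (t + δ)⁻¹ * t * (δ * (t + δ)⁻¹)) h := by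
      have hc' : ContinuousOn (fun t : ℝ => δ * (t + δ)⁻¹) (spectrum ℝ h) :=
        continuousOn_const.mul hc
      rw [cfc_mul (fun t : ℝ => δ * (t + δ)⁻¹ * t) (fun t : ℝ => δ * (t + δ)⁻¹) h
          (hc'.mul (g := fun t => t) (by fun_prop)) hc',
        cfc_mul (fun t : ℝ => δ * (t + δ)⁻¹) (fun t => t) h hc' (by fun_prop), cfc_id' ℝ h, ← h1e,
        hdsa]
    have h4 : ‖d * h * star d‖ ≤ δ := by
      rw [h3]
      refine norm_cfc_le hδ0.le fun t ht => ?_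
      have ht0 := hspec t ht
      rw [Real.norm_of_nonneg (by positivity)]
      have h5 : (t + δ)⁻¹ * t ≤ 1 := by
        rw [inv_mul_le_iff₀ (by positivity)]; linarith
      have h6 : δ * (t + δ)⁻¹ ≤ 1 := by
        rw [mul_inv_le_iff₀ (by positivity)]; linarith
      calc δ * (t + δ)⁻¹ * t * (δ * (t + δ)⁻¹) = δ * (((t + δ)⁻¹ * t) * (δ * (t + δ)⁻¹)) := by ring
        _ ≤ δ * (1 * 1) := by gcongr
        _ = δ := by ring
    have h7 : ‖d * s‖ * ‖d * s‖ ≤ η ^ 2 := by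
      rw [← CStarRing.norm_self_mul_star, star_mul, mul_assoc, ← mul_assoc s, ← mul_assoc]
      exact (CStarAlgebra.norm_le_norm_of_nonneg_of_le
        (star_right_conjugate_nonneg (mul_star_self_nonneg s) d) h2).trans h4
    exact abs_le_of_sq_le_sq' (by nlinarith) hη.le |>.2

/-- Almost orthogonality improves the trivial bound of order $N$ to order $\sqrt N$. In the double
sum for $XX^*$ each row has at most three terms near the diagonal, of size $4\|a\|^2$, and the
others contribute at most $N\cdot(4/N)\|a\|^2$; so $\|X\|^2\le 16N\|a\|^2$. -/
theorem norm_sum_mul_le {N : ℕ} (hN : 0 < N) {a : R} {e d : ℕ → R} (he : ∀ m, ‖e m‖ ≤ 1)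
    (hd : ∀ m, ‖d m‖ ≤ 2) (hdd : ∀ m m', m + 2 ≤ m' → ‖d m * star (d m')‖ ≤ 4 / N)
    (hdd' : ∀ m m', m' + 2 ≤ m → ‖d m * star (d m')‖ ≤ 4 / N) :
    ‖∑ m ∈ Finset.range N, e m * a * d m‖ ≤ 4 * ‖a‖ * √N := by
  have hN' : (0 : ℝ) < N := by exact_mod_cast hN
  set X := ∑ m ∈ Finset.range N, e m * a * d m with hX
  -- For $m=0$ the truncated `m - 1` equals `m`, so the diagonal is counted twice; this only
  -- enlarges the upper bound.
  have hterm : ∀ m m', ‖(e m * a * d m) * star (e m' * a * d m')‖ ≤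
      ‖a‖ ^ 2 * (4 / N + ((if m' = m then 4 else 0) + (if m' = m + 1 then 4 else 0) +
        (if m' = m - 1 then 4 else 0))) := by
    intro m m'
    have h1 : ‖d m * star (d m')‖ ≤ 4 / N + ((if m' = m then 4 else 0) +
        (if m' = m + 1 then 4 else 0) + (if m' = m - 1 then 4 else 0)) := by
      have h2 : ‖d m * star (d m')‖ ≤ 4 := by
        refine (norm_mul_le _ _).trans ?_
        rw [norm_star]
        nlinarith [hd m, hd m', norm_nonneg (d m), norm_nonneg (d m')]
      have h3 : (0 : ℝ) ≤ 4 / N := by positivity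
      by_cases c1 : m + 2 ≤ m'
      · have := hdd m m' c1
        split_ifs <;> linarith
      by_cases c2 : m' + 2 ≤ m
      · have := hdd' m m' c2
        split_ifs <;> linarith
      have : m' = m ∨ m' = m + 1 ∨ m' = m - 1 := by omega
      split_ifs <;> first | linarith | omega
    calc ‖(e m * a * d m) * star (e m' * a * d m')‖
        = ‖(e m * a) * (d m * star (d m')) * (star a * star (e m'))‖ := by
          rw [star_mul, star_mul]; simp only [mul_assoc]
      _ ≤ (‖e m‖ * ‖a‖) * ‖d m * star (d m')‖ * (‖star a‖ * ‖star (e m')‖) := by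
          refine (norm_mul_le _ _).trans (mul_le_mul ((norm_mul_le _ _).trans ?_)
            (norm_mul_le _ _) (norm_nonneg _) (by positivity))
          gcongr
          exact norm_mul_le _ _
      _ ≤ (1 * ‖a‖) * ‖d m * star (d m')‖ * (‖a‖ * 1) := by
          rw [norm_star, norm_star]
          gcongr
          · exact he m
          · exact he m'
      _ = ‖a‖ ^ 2 * ‖d m * star (d m')‖ := by ring
      _ ≤ _ := by gcongr
  have hsq : ‖X‖ * ‖X‖ ≤ ‖a‖ ^ 2 * (16 * N) := by
    rw [← CStarRing.norm_self_mul_star, hX, star_sum, Finset.sum_mul_sum]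
    refine (norm_sum_le _ _).trans ?_
    have hrow : ∀ m ∈ Finset.range N, ‖∑ m' ∈ Finset.range N,
        (e m * a * d m) * star (e m' * a * d m')‖ ≤ ‖a‖ ^ 2 * 16 := by
      intro m _
      refine (norm_sum_le _ _).trans ((Finset.sum_le_sum fun m' _ => hterm m m').trans ?_)
      rw [← Finset.mul_sum]
      refine mul_le_mul_of_nonneg_left ?_ (by positivity)
      simp only [Finset.sum_add_distrib, Finset.sum_ite_eq', Finset.sum_const, Finset.card_range,
        nsmul_eq_mul]
      rw [mul_div_cancel₀ _ hN'.ne']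
      split_ifs <;> norm_num
    refine (Finset.sum_le_sum hrow).trans (le_of_eq ?_)
    rw [Finset.sum_const, Finset.card_range, nsmul_eq_mul]; ring
  refine abs_le_of_sq_le_sq' (a := ‖X‖) ?_ (by positivity) |>.2
  rw [mul_pow, Real.sq_sqrt hN'.le]
  nlinarith

/-- The averaging argument behind quasicentral approximate units: the mean of a sequence of positive
contractions, each of which is almost a unit for the preceding ones and for their products with `a`
and `a*`, almost commutes with `a`. -/
theorem norm_commutator_average_le {N : ℕ} (hN : 0 < N) {a : R} {e : ℕ → R}
    (h0 : ∀ m, 0 ≤ e m) (h1 : ∀ m, e m ≤ 1)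
    (hee : ∀ m n, m < n → ‖(1 - e n) * e m‖ ≤ 1 / N)
    (hae : ∀ m n, m < n → ‖(1 - e n) * (a * e m)‖ ≤ 1 / N)
    (hae' : ∀ m n, m < n → ‖(1 - e n) * (star a * e m)‖ ≤ 1 / N) :
    ‖(∑ m ∈ Finset.range N, e m) * a - a * ∑ m ∈ Finset.range N, e m‖ ≤
      2 + 8 * ‖a‖ * √N := by
  have hN' : (0 : ℝ) < N := by exact_mod_cast hN
  have hsa : ∀ m, star (e m) = e m := fun m => (h0 m).isSelfAdjoint
  set d : ℕ → R := fun m => e (m + 1) - e m with hd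
  have hdsa : ∀ m, star (d m) = d m := fun m => by simp only [hd, star_sub, hsa]
  have hen : ∀ m, ‖e m‖ ≤ 1 := fun m => norm_le_one_of_nonneg_of_le_one (h0 m) (h1 m)
  have hdn : ∀ m, ‖d m‖ ≤ 2 := fun m =>
    (norm_sub_le _ _).trans (by linarith [hen m, hen (m + 1)])
  -- The gap of two makes both $m$ and $m+1$ precede $m'$, so each of the four products $(1-e_i)e_j$
  -- in the expansion has norm at most $1/N$.
  have key : ∀ m m', m + 2 ≤ m' → ‖d m' * d m‖ ≤ 4 / N := by
    intro m m' h
    have e1 : d m' * d m = ((1 - e m') * e (m + 1) - (1 - e m') * e m) -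
        ((1 - e (m' + 1)) * e (m + 1) - (1 - e (m' + 1)) * e m) := by
      simp only [hd]; noncomm_ring
    rw [e1]
    refine (norm_sub_le _ _).trans ((add_le_add (norm_sub_le _ _) (norm_sub_le _ _)).trans ?_)
    have := hee (m + 1) m' (by omega)
    have := hee m m' (by omega)
    have := hee (m + 1) (m' + 1) (by omega)
    have := hee m (m' + 1) (by omega)
    have : (4 : ℝ) / N = 1 / N + 1 / N + (1 / N + 1 / N) := by ring
    linarith
  have key' : ∀ m m', m + 2 ≤ m' → ‖d m * d m'‖ ≤ 4 / N := by
    intro m m' h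
    rw [← norm_star, star_mul, hdsa, hdsa]; exact key m m' h
  have hX : ∀ b : R, ‖∑ m ∈ Finset.range N, e m * b * d m‖ ≤ 4 * ‖b‖ * √N := fun b =>
    norm_sum_mul_le hN hen hdn (fun m m' h => by rw [hdsa]; exact key' m m' h)
      (fun m m' h => by rw [hdsa]; exact key m' m h)
  have hX' : ‖∑ m ∈ Finset.range N, d m * a * e m‖ ≤ 4 * ‖a‖ * √N := by
    have h := hX (star a)
    rw [← norm_star, star_sum, norm_star] at h
    refine le_of_eq_of_le ?_ h
    refine congrArg _ (Finset.sum_congr rfl fun m _ => ?_)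
    rw [star_mul, star_mul, hsa, hdsa, star_star, mul_assoc]
  -- Insert $1=(1-e_{m+1})+e_{m+1}$ next to $a$ and subtract the common term $e_mae_m$. The parts
  -- with $1-e_{m+1}$ are small one by one ($N$ terms of size $2/N$); the parts with
  -- $d_m=e_{m+1}-e_m$ are small only as sums.
  have hsplit : (∑ m ∈ Finset.range N, e m) * a - a * ∑ m ∈ Finset.range N, e m =
      ∑ m ∈ Finset.range N, (e m * a * (1 - e (m + 1)) - (1 - e (m + 1)) * (a * e m)) +
      (∑ m ∈ Finset.range N, e m * a * d m - ∑ m ∈ Finset.range N, d m * a * e m) := by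
    rw [Finset.sum_mul, Finset.mul_sum, ← Finset.sum_sub_distrib, ← Finset.sum_sub_distrib,
      ← Finset.sum_add_distrib]
    refine Finset.sum_congr rfl fun m _ => ?_
    simp only [hd]; noncomm_ring
  have herr : ‖∑ m ∈ Finset.range N,
      (e m * a * (1 - e (m + 1)) - (1 - e (m + 1)) * (a * e m))‖ ≤ 2 := by
    refine (norm_sum_le_of_le _ (fun m _ => (norm_sub_le _ _).trans (add_le_add
      (?_ : _ ≤ 1 / (N : ℝ)) (hae m (m + 1) (by omega))))).trans (le_of_eq ?_)
    · rw [← norm_star, star_mul, star_mul, hsa, star_sub, star_one, hsa]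
      exact hae' m (m + 1) (by omega)
    · rw [Finset.sum_const, Finset.card_range, nsmul_eq_mul]
      field_simp
      norm_num
  rw [hsplit]
  refine (norm_add_le _ _).trans ?_
  have := norm_sub_le (∑ m ∈ Finset.range N, e m * a * d m) (∑ m ∈ Finset.range N, d m * a * e m)
  have := hX a
  linarith

theorem norm_average_le {N : ℕ} (hN : 0 < N) {x : ℕ → R} {η : ℝ}
    (hx : ∀ m ∈ Finset.range N, ‖x m‖ ≤ η) : ‖(N : ℝ)⁻¹ • ∑ m ∈ Finset.range N, x m‖ ≤ η := by
  have hN' : (0 : ℝ) < N := by exact_mod_cast hN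
  rw [norm_smul, norm_inv, Real.norm_of_nonneg hN'.le, inv_mul_le_iff₀ hN']
  refine (norm_sum_le_of_le _ hx).trans (le_of_eq ?_)
  rw [Finset.sum_const, Finset.card_range, nsmul_eq_mul]

theorem average_const {N : ℕ} (hN : 0 < N) (x : R) :
    (N : ℝ)⁻¹ • ∑ _m ∈ Finset.range N, x = x := by
  have hN' : (N : ℝ) ≠ 0 := by exact_mod_cast hN.ne'
  rw [Finset.sum_const, Finset.card_range, ← Nat.cast_smul_eq_nsmul ℝ, smul_smul,
    inv_mul_cancel₀ hN', one_smul]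

theorem average_nonneg {N : ℕ} {e : ℕ → R} (h0 : ∀ m, 0 ≤ e m) :
    0 ≤ (N : ℝ)⁻¹ • ∑ m ∈ Finset.range N, e m :=
  smul_nonneg (by positivity) (Finset.sum_nonneg fun m _ => h0 m)

theorem one_sub_average {N : ℕ} (hN : 0 < N) (e : ℕ → R) :
    1 - (N : ℝ)⁻¹ • ∑ m ∈ Finset.range N, e m =
      (N : ℝ)⁻¹ • ∑ m ∈ Finset.range N, (1 - e m) := by
  rw [Finset.sum_sub_distrib, smul_sub, average_const hN]

theorem average_le_one {N : ℕ} (hN : 0 < N) {e : ℕ → R} (h1 : ∀ m, e m ≤ 1) :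
    (N : ℝ)⁻¹ • ∑ m ∈ Finset.range N, e m ≤ 1 := by
  rw [← sub_nonneg, one_sub_average hN]
  exact average_nonneg fun m => sub_nonneg.2 (h1 m)

theorem average_mem (J : Ideal R) {N : ℕ} {e : ℕ → R} (hJ : ∀ m, e m ∈ J) :
    (N : ℝ)⁻¹ • ∑ m ∈ Finset.range N, e m ∈ J :=
  J.smul_of_tower_mem _ (J.sum_mem fun m _ => hJ m)

/-- Chooses the length of both averages: $C=8\sup\|a\|$ for the commutator estimate, and $C=0$ for
the telescoping error $2/N$ of the invariant average. -/
theorem exists_nat_average_bound (C : ℝ) {ε : ℝ} (hε : 0 < ε) :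
    ∃ N : ℕ, 0 < N ∧ 1 / (N : ℝ) ≤ ε ∧ (N : ℝ)⁻¹ * (2 + C * √N) ≤ ε := by
  have h1 : Tendsto (fun N : ℕ => 1 / (N : ℝ)) atTop (𝓝 0) := tendsto_one_div_atTop_nhds_zero_nat
  have h2 : Tendsto (fun N : ℕ => 2 * (1 / (N : ℝ)) + C * √(1 / (N : ℝ))) atTop (𝓝 0) := by
    simpa using (h1.const_mul 2).add (h1.sqrt.const_mul C)
  obtain ⟨N, hN, hN1, hN2⟩ := ((eventually_gt_atTop 0).and
    ((h1.eventually_le_const hε).and (h2.eventually_le_const hε))).exists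
  refine ⟨N, hN, hN1, le_of_eq_of_le ?_ hN2⟩
  have hN' : (0 : ℝ) < N := by exact_mod_cast hN
  rw [one_div, Real.sqrt_inv, mul_add, mul_comm, ← mul_assoc, mul_comm _ C, mul_assoc]
  congr 2
  nth_rewrite 1 [← Real.mul_self_sqrt hN'.le]
  field_simp

/-- Finitary form of the existence of quasicentral approximate units in a two-sided ideal of a
`C*`-algebra. -/
theorem exists_quasicentral (J : Ideal R) [J.IsTwoSided] {S F : Set R} (hS : S.Finite)
    (hSJ : ∀ s ∈ S, s ∈ J) (hF : F.Finite) {ε : ℝ} (hε : 0 < ε) :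
    ∃ e ∈ J, 0 ≤ e ∧ e ≤ 1 ∧ (∀ s ∈ S, ‖(1 - e) * s‖ ≤ ε) ∧
      ∀ a ∈ F, ‖e * a - a * e‖ ≤ ε := by
  obtain ⟨C, hC⟩ := (hF.image fun a => ‖a‖).bddAbove
  obtain ⟨N, hN, hN1, hN2⟩ := exists_nat_average_bound (8 * C) hε
  have hN' : (0 : ℝ) < N := by exact_mod_cast hN
  -- Each new term is an almost unit for $S$ and for all $bx$ with $x$ an earlier term and
  -- $b\in\{1\}\cup F\cup F^*$; the factor $b=1$ handles the earlier terms themselves.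
  obtain ⟨e, he, hee⟩ := exists_seq_of_forall_finset_exists
    (fun e : R => e ∈ J ∧ 0 ≤ e ∧ e ≤ 1 ∧ ∀ s ∈ S, ‖(1 - e) * s‖ ≤ 1 / N)
    (fun x y : R => ‖(1 - y) * x‖ ≤ 1 / N ∧ ∀ a ∈ F, ‖(1 - y) * (a * x)‖ ≤ 1 / N ∧
      ‖(1 - y) * (star a * x)‖ ≤ 1 / N) fun T hT => by
    set G : Set R := (fun p : R × R => p.1 * p.2) '' ((insert 1 (F ∪ star '' F)) ×ˢ (T : Set R))
      with hG
    have hGf : G.Finite :=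
      (((hF.union (hF.image _)).insert 1).prod T.finite_toSet).image _
    have hmem : ∀ x ∈ T, ∀ b ∈ insert 1 (F ∪ star '' F), b * x ∈ G := fun x hx b hb =>
      ⟨(b, x), ⟨hb, hx⟩, rfl⟩
    obtain ⟨y, hyJ, hy0, hy1, hy⟩ := exists_almost_unit J (hS.union hGf) (fun s hs => by
      rcases hs with hs | ⟨⟨b, x⟩, ⟨-, hx⟩, rfl⟩
      · exact hSJ s hs
      · exact J.mul_mem_left _ (hT x hx).1) (η := 1 / N) (by positivity)
    refine ⟨y, ⟨hyJ, hy0, hy1, fun s hs => hy s (Or.inl hs)⟩, fun x hx => ⟨?_, fun a ha => ⟨?_, ?_⟩⟩⟩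
    · have := hy _ (Or.inr (hmem x hx 1 (Or.inl rfl)))
      rwa [one_mul] at this
    · exact hy _ (Or.inr (hmem x hx a (Or.inr (Or.inl ha))))
    · exact hy _ (Or.inr (hmem x hx _ (Or.inr (Or.inr ⟨a, ha, rfl⟩))))
  refine ⟨(N : ℝ)⁻¹ • ∑ m ∈ Finset.range N, e m, average_mem J fun m => (he m).1,
    average_nonneg fun m => (he m).2.1, average_le_one hN fun m => (he m).2.2.1,
    fun s hs => ?_, fun a ha => ?_⟩
  · rw [one_sub_average hN, smul_mul_assoc, Finset.sum_mul]
    exact norm_average_le hN fun m _ => ((he m).2.2.2 s hs).trans hN1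
  · rw [smul_mul_assoc, mul_smul_comm, ← smul_sub, norm_smul, norm_inv,
      Real.norm_of_nonneg hN'.le]
    refine le_trans ?_ hN2
    have haC : ‖a‖ ≤ C := hC ⟨a, ha, rfl⟩
    refine mul_le_mul_of_nonneg_left ((norm_commutator_average_le hN (fun m => (he m).2.1)
      (fun m => (he m).2.2.1) (fun m n h => (hee m n h).1) (fun m n h => ((hee m n h).2 a ha).1)
      (fun m n h => ((hee m n h).2 a ha).2)).trans ?_) (by positivity)
    gcongr

/-- The iterates of a `*`-automorphism. -/
def iterateAut (β : R ≃⋆ₐ[ℂ] R) : ℕ → (R ≃⋆ₐ[ℂ] R)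
  | 0 => StarAlgEquiv.refl ℂ R
  | i + 1 => (iterateAut β i).trans β

theorem iterateAut_succ (β : R ≃⋆ₐ[ℂ] R) (i : ℕ) (x : R) :
    iterateAut β (i + 1) x = β (iterateAut β i x) := rfl

theorem iterateAut_mem (β : R ≃⋆ₐ[ℂ] R) {J : Ideal R} (hβ : ∀ x, β x ∈ J ↔ x ∈ J) (i : ℕ) (x : R) :
    iterateAut β i x ∈ J ↔ x ∈ J := by
  induction i with
  | zero => exact Iff.rfl
  | succ i ih => rw [iterateAut_succ, hβ, ih]

theorem aut_nonneg (β : R ≃⋆ₐ[ℂ] R) {x : R} (hx : 0 ≤ x) : 0 ≤ β x := by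
  obtain ⟨y, rfl⟩ := CStarAlgebra.nonneg_iff_eq_star_mul_self.1 hx
  rw [map_mul, map_star]
  exact star_mul_self_nonneg _

theorem aut_le_one (β : R ≃⋆ₐ[ℂ] R) {x : R} (hx : x ≤ 1) : β x ≤ 1 := by
  have := aut_nonneg β (sub_nonneg.2 hx)
  rwa [map_sub, map_one, sub_nonneg] at this

/-- A two-sided ideal that is invariant under a `*`-automorphism contains quasicentral almost units
that are almost fixed by it. -/
theorem exists_quasicentral_invariant (β : R ≃⋆ₐ[ℂ] R) (J : Ideal R) [J.IsTwoSided]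
    (hβ : ∀ x, β x ∈ J ↔ x ∈ J) {S F : Set R} (hS : S.Finite)
    (hSJ : ∀ s ∈ S, s ∈ J) (hF : F.Finite) {ε : ℝ} (hε : 0 < ε) :
    ∃ e ∈ J, 0 ≤ e ∧ e ≤ 1 ∧ (∀ s ∈ S, ‖(1 - e) * s‖ ≤ ε) ∧
      (∀ a ∈ F, ‖e * a - a * e‖ ≤ ε) ∧ ‖β e - e‖ ≤ ε := by
  obtain ⟨N, hN, -, hN2⟩ := exists_nat_average_bound 0 hε
  have hN' : (0 : ℝ) < N := by exact_mod_cast hN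
  set γ := iterateAut β with hγ
  -- Asking $e$ to be good for all pull-backs $\beta^{-i}(S)$ and $\beta^{-i}(F)$, $i<N$, makes each
  -- iterate $\beta^i(e)$ good for $S$ and $F$, because $\beta^i$ is isometric.
  have hfin : ∀ {T : Set R}, T.Finite → (⋃ i ∈ Finset.range N, (γ i).symm '' T).Finite :=
    fun hT => (Finset.range N).finite_toSet.biUnion fun i _ => hT.image _
  obtain ⟨e, heJ, he0, he1, heS, heF⟩ := exists_quasicentral J (hfin hS) (fun s hs => by
    simp only [Set.mem_iUnion] at hs
    obtain ⟨i, -, t, ht, rfl⟩ := hs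
    rw [← iterateAut_mem β hβ i, ← hγ, StarAlgEquiv.apply_symm_apply]
    exact hSJ t ht) (hfin hF) hε
  have hmem : ∀ (T : Set R), ∀ t ∈ T, ∀ i ∈ Finset.range N,
      (γ i).symm t ∈ ⋃ i ∈ Finset.range N, (γ i).symm '' T := fun T t ht i hi => by
    simp only [Set.mem_iUnion]
    exact ⟨i, hi, t, ht, rfl⟩
  refine ⟨(N : ℝ)⁻¹ • ∑ i ∈ Finset.range N, γ i e,
    average_mem J fun i => (iterateAut_mem β hβ i e).2 heJ,
    average_nonneg fun i => aut_nonneg _ he0, average_le_one hN fun i => aut_le_one _ he1,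
    fun s hs => ?_, fun a ha => ?_, ?_⟩
  · rw [one_sub_average hN, smul_mul_assoc, Finset.sum_mul]
    refine norm_average_le hN fun i hi => ?_
    have h := heS _ (hmem S s hs i hi)
    rw [← norm_aut (γ i), map_mul, map_sub, map_one, StarAlgEquiv.apply_symm_apply] at h
    exact h
  · rw [smul_mul_assoc, mul_smul_comm, ← smul_sub, Finset.sum_mul, Finset.mul_sum,
      ← Finset.sum_sub_distrib]
    refine norm_average_le hN fun i hi => ?_
    have h := heF _ (hmem F a ha i hi)
    rw [← norm_aut (γ i), map_sub, map_mul, map_mul, StarAlgEquiv.apply_symm_apply] at h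
    exact h
  -- Applying $\beta$ shifts the average by one step, so the difference telescopes to
  -- $N^{-1}(\beta^N(e)-e)$, of norm at most $2/N$. The scalar is moved to `ℂ` because `β` is
  -- complex linear.
  · have h1 : β ((N : ℝ)⁻¹ • ∑ i ∈ Finset.range N, γ i e) =
        (N : ℝ)⁻¹ • ∑ i ∈ Finset.range N, γ (i + 1) e := by
      rw [← algebraMap_smul ℂ (N : ℝ)⁻¹, ← algebraMap_smul ℂ (N : ℝ)⁻¹, map_smul, map_sum]
      rfl
    rw [h1, ← smul_sub, ← Finset.sum_sub_distrib, Finset.sum_range_sub (fun i => γ i e), norm_smul,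
      norm_inv, Real.norm_of_nonneg hN'.le]
    refine le_trans (mul_le_mul_of_nonneg_left ?_ (by positivity)) hN2
    refine (norm_sub_le _ _).trans ?_
    rw [norm_aut, norm_aut]
    have := norm_le_one_of_nonneg_of_le_one he0 he1
    linarith

end Quasicentral

/-! ### The uniform 2-norm as a supremum over extreme traces -/

section KreinMilman

variable (A : Type*) [CStarAlgebra A]

theorem isClosed_tracialStates : IsClosed (tracialStates A) := by
  have hev : ∀ a : A, Continuous fun τ : WeakDual ℂ A => τ a := WeakDual.eval_continuous
  have h1 : IsClosed {τ : WeakDual ℂ A | τ 1 = 1} := isClosed_eq (hev 1) continuous_const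
  have h2 : IsClosed {τ : WeakDual ℂ A | ∀ a, 0 ≤ τ (star a * a)} := by
    rw [Set.ofPred_forall]
    exact isClosed_iInter fun a => isClosed_Ici.preimage (hev (star a * a))
  have h3 : IsClosed {τ : WeakDual ℂ A | ∀ a b, τ (a * b) = τ (b * a)} := by
    simp only [Set.ofPred_forall]
    exact isClosed_iInter fun a => isClosed_iInter fun b => isClosed_eq (hev _) (hev _)
  exact h1.inter (h2.inter h3)

theorem isCompact_tracialStates : IsCompact (tracialStates A) := by
  refine (WeakDual.isCompact_closedBall (𝕜 := ℂ) (0 : StrongDual ℂ A) 1).of_isClosed_subset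
    (isClosed_tracialStates A) fun τ hτ => ?_
  rw [Set.mem_preimage, mem_closedBall_zero_iff]
  refine ContinuousLinearMap.opNorm_le_bound _ zero_le_one fun a => ?_
  rw [one_mul]
  exact ((traceNorm_props hτ).2.2 a).trans (traceNorm_le_norm hτ a)

theorem convex_tracialStates : Convex ℝ (tracialStates A) := by
  intro σ hσ τ hτ s t hs ht hst
  have hap : ∀ a, (s • σ + t • τ) a = (s : ℂ) * σ a + (t : ℂ) * τ a := fun a => by
    rw [← Complex.real_smul, ← Complex.real_smul]; rfl
  refine ⟨?_, fun a => ?_, fun a b => ?_⟩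
  · rw [hap, hσ.1, hτ.1, mul_one, mul_one]
    exact_mod_cast hst
  · rw [hap]
    have hs' : (0 : ℂ) ≤ s := by exact_mod_cast hs
    have ht' : (0 : ℂ) ≤ t := by exact_mod_cast ht
    exact add_nonneg (mul_nonneg hs' (hσ.2.1 a)) (mul_nonneg ht' (hτ.2.1 a))
  · rw [hap, hap, hσ.2.2, hτ.2.2]

/-- Traces are complex linear, but convexity and the Krein-Milman theorem are real notions; this
instance and the next treat the weak-$*$ dual as a real locally convex space. -/
instance : IsScalarTower ℝ ℂ (WeakDual ℂ A) :=
  ⟨fun r z τ => DFunLike.ext _ _ fun a => smul_assoc r z (τ a)⟩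

instance : LocallyConvexSpace ℝ (WeakDual ℂ A) :=
  WeakBilin.locallyConvexSpace (𝕜 := ℂ) (B := topDualPairing ℂ A)

variable {A}

/-- By the Krein-Milman theorem, the supremum defining `‖·‖_{2,u}` may be taken over the extreme
traces. -/
theorem extremeTwoNorm_eq_uniformTwoNorm (a : A) : extremeTwoNorm A a = uniformTwoNorm A a := by
  apply le_antisymm
  · exact Real.iSup_le (fun τ => traceNorm_le_iSup subset_rfl a τ.2.1) ((uniformTwoNorm A).nonneg a)
  · refine Real.iSup_le (fun τ => ?_) ((extremeTwoNorm A).nonneg a)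
    set C := extremeTwoNorm A a with hC
    have hC0 : 0 ≤ C := (extremeTwoNorm A).nonneg a
    -- The square of the 2-norm is real linear and weak-$*$ continuous in the trace, so its sublevel
    -- set is closed and convex; containing the extreme traces, it contains all of $T(A)$.
    set K : Set (WeakDual ℂ A) := {σ | (σ (star a * a)).re ≤ C ^ 2} with hK
    have hclosed : IsClosed K := isClosed_Iic.preimage
      (Complex.continuous_re.comp (WeakDual.eval_continuous (star a * a)))
    have hconv : Convex ℝ K := by
      intro σ hσ ρ hρ s t hs ht hst
      have hap : ((s • σ + t • ρ) (star a * a)).re =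
          s * (σ (star a * a)).re + t * (ρ (star a * a)).re := by
        rw [← Complex.re_ofReal_mul, ← Complex.re_ofReal_mul, ← Complex.add_re,
          ← Complex.real_smul, ← Complex.real_smul]
        rfl
      rw [hK, Set.mem_ofPred_eq, hap]
      calc _ ≤ s * C ^ 2 + t * C ^ 2 := add_le_add (mul_le_mul_of_nonneg_left hσ hs)
            (mul_le_mul_of_nonneg_left hρ ht)
        _ = C ^ 2 := by rw [← add_mul, hst, one_mul]
    have hext : extremeTraces A ⊆ K := fun σ hσ =>
      (Real.sqrt_le_left hC0).1 (traceNorm_le_iSup (extremeTraces_subset A) a hσ)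
    have hsub : tracialStates A ⊆ K := by
      have h := closure_convexHull_extremePoints (E := WeakDual ℂ A) (isCompact_tracialStates A)
        (convex_tracialStates A)
      exact h.ge.trans (closure_minimal (convexHull_min hext hconv) hclosed)
    exact Real.sqrt_le_iff.2 ⟨hC0, hsub τ.2⟩

end KreinMilman

/-! ### The map from bounded sequences in `A` onto the ultrapower of the bundle -/

section SeqMap

variable (A : Type*) [CStarAlgebra A]

/-- The canonical map `A → M`. -/
def toCompletion : A →⋆ₐ[ℂ] Completion A :=
  Completion.mk.comp (StarAlgHom.codRestrict (constSeq A) (cauchySeqs A) fun a ε hε =>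
    ⟨0, fun _ _ _ _ => by
      change uniformTwoNorm A (a - a) < ε
      rwa [sub_self, (uniformTwoNorm A).map_zero]⟩)

variable {A}

theorem norm_toCompletion_le (a : A) : ‖toCompletion A a‖ ≤ ‖a‖ :=
  (norm_mk_le (nullCauchySeqs A) _).trans
    ((BoundedContinuousFunction.norm_le (norm_nonneg a)).2 fun _ => le_rfl)

/-- The norm of the bundle sees only extreme traces, that of $A$ all traces; Krein-Milman makes the
canonical map isometric for the 2-norms, which identifies the kernel of `seqToBundle`. -/
theorem bundleTwoNorm_toCompletion (a : A) :
    bundleTwoNorm A (toCompletion A a) = uniformTwoNorm A a := by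
  rw [← extremeTwoNorm_eq_uniformTwoNorm]
  exact tendsto_nhds_unique (tendsto_bundleTwoNorm _) tendsto_const_nhds

/-- A late term of a representing Cauchy sequence works. The norm bound, obtained by choosing a
representative of norm below $\|x\|+1$, keeps termwise approximants of a bounded sequence bounded.
-/
theorem exists_bundleTwoNorm_sub_le (x : Completion A) {ε : ℝ} (hε : 0 < ε) :
    ∃ a : A, ‖a‖ ≤ ‖x‖ + 1 ∧ bundleTwoNorm A (toCompletion A a - x) ≤ ε := by
  obtain ⟨y, rfl, hy⟩ := Completion.exists_norm_mk_lt x one_pos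
  obtain ⟨k, hk⟩ := y.2 ε hε
  refine ⟨y.1 k, (y.1.norm_coe_le_norm k).trans hy.le, ?_⟩
  rw [toCompletion, StarAlgHom.comp_apply, ← map_sub]
  refine le_of_tendsto (tendsto_bundleTwoNorm _) ((eventually_ge_atTop k).mono fun n hn => ?_)
  rw [extremeTwoNorm_eq_uniformTwoNorm]
  exact (hk k le_rfl n hn).le

variable (A) in
/-- The canonical map `A → M` applied termwise to bounded sequences. -/
def seqToCompletion : (ℕ →ᵇ A) →⋆ₐ[ℂ] (ℕ →ᵇ Completion A) where
  toFun x := BoundedContinuousFunction.ofNormedAddCommGroupDiscrete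
    (fun n => toCompletion A (x n)) ‖x‖
    fun n => (norm_toCompletion_le _).trans (x.norm_coe_le_norm n)
  map_one' := by ext n; exact map_one (toCompletion A)
  map_mul' x y := by ext n; exact map_mul (toCompletion A) (x n) (y n)
  map_zero' := by ext n; exact map_zero (toCompletion A)
  map_add' x y := by ext n; exact map_add (toCompletion A) (x n) (y n)
  commutes' c := by ext n; exact AlgHomClass.commutes (toCompletion A) c
  map_star' x := by ext n; exact map_star (toCompletion A) (x n)

variable (A) (ω : Ultrafilter ℕ)

/-- The canonical map from the bounded sequences in `A` to `M^ω`. -/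
def seqToBundle : (ℕ →ᵇ A) →⋆ₐ[ℂ] BundleUltrapower A ω :=
  (BundleUltrapower.mk ω).comp (seqToCompletion A)

variable {A}

theorem seqToBundle_eq_zero_iff (x : ℕ →ᵇ A) :
    seqToBundle A ω x = 0 ↔ x ∈ nullIdeal (uniformTwoNorm A) (ω : Filter ℕ) := by
  refine (Ideal.Quotient.eq_zero_iff_mem
    (I := nullIdeal (bundleTwoNorm A) (ω : Filter ℕ))).trans ?_
  simp only [mem_nullIdeal]
  exact iff_of_eq (congrArg (fun f => Tendsto f _ _)
    (funext fun n => bundleTwoNorm_toCompletion (x n)))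

theorem seqToBundle_eq_iff (x y : ℕ →ᵇ A) :
    seqToBundle A ω x = seqToBundle A ω y ↔
      x - y ∈ nullIdeal (uniformTwoNorm A) (ω : Filter ℕ) := by
  rw [← seqToBundle_eq_zero_iff, map_sub, sub_eq_zero]

theorem seqToBundle_constSeq (a : A) :
    seqToBundle A ω (constSeq A a) = toBundleUltrapower A ω (toCompletion A a) := rfl

theorem seqToBundle_seqAut (α : A ≃⋆ₐ[ℂ] A) (x : ℕ →ᵇ A) :
    seqToBundle A ω (seqAut α (norm_aut α) x) = bundleUltrapowerAut ω α (seqToBundle A ω x) := rfl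

theorem tendsto_seqToBundle (x : ℕ →ᵇ A) :
    Tendsto (fun n => uniformTwoNorm A (x n)) ω
      (𝓝 (bundleUltrapowerTwoNorm A ω (seqToBundle A ω x))) := by
  refine (tendsto_limSeminorm ω (bundleTwoNorm A) (bundleTwoNorm A) (fun _ => le_rfl)
    (seqToCompletion A x)).congr fun n => ?_
  exact bundleTwoNorm_toCompletion (x n)

variable {ω} in
theorem seqToBundle_surjective (hω : (ω : Filter ℕ) ≤ cofinite) :
    Function.Surjective (seqToBundle A ω) := by
  intro p
  obtain ⟨x, rfl⟩ := Ideal.Quotient.mk_surjective p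
  choose a ha ha' using fun n : ℕ => exists_bundleTwoNorm_sub_le (x n)
    (Nat.one_div_pos_of_nat (α := ℝ) (n := n))
  let y : ℕ →ᵇ A := BoundedContinuousFunction.ofNormedAddCommGroupDiscrete a (‖x‖ + 1) fun n =>
    (ha n).trans (by gcongr; exact x.norm_coe_le_norm n)
  -- The $n$-th error is at most $1/(n+1)$, which tends to $0$ along $\omega$ because $\omega$ is
  -- free.
  refine ⟨y, Ideal.Quotient.eq.2 (squeeze_zero (fun n => (bundleTwoNorm A).nonneg _) ha'
    ((tendsto_one_div_add_atTop_nhds_zero_nat (𝕜 := ℝ)).mono_left ?_))⟩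
  rwa [← Nat.cofinite_eq_atTop]

end SeqMap

/-! ### Lifting towers of projections -/

section Lifting

/-- Apply $g(t)=t/(1-t+t^2)$ to the positive lift $q=y^*y$. On $[0,\infty)$ one has $0\le g\le1$,
because $1-t+t^2-t=(1-t)^2\ge0$. As $g$ is rational, the identity $g(q)(1-q+q^2)=q$ can be pushed to
$Q$ algebraically, where $1-p+p^2=1$; no functional calculus in $Q$ is needed. -/
theorem exists_contraction_lift {R Q : Type*} [CStarAlgebra R] [PartialOrder R] [StarOrderedRing R]
    [Ring Q] [StarRing Q] [Algebra ℂ Q] (Φ : R →⋆ₐ[ℂ] Q) (hΦ : Function.Surjective Φ) {p : Q}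
    (hp : IsStarProjection p) :
    ∃ z : R, (∃ b, z = star b * b) ∧ ‖z‖ ≤ 1 ∧ Φ z = p := by
  obtain ⟨y, hy⟩ := hΦ p
  set q := star y * y with hq
  have hpp : p * p = p := hp.isIdempotentElem
  have hΦq : Φ q = p := by
    rw [hq, map_mul, map_star, hy, hp.isSelfAdjoint.star_eq, hpp]
  have hq0 : 0 ≤ q := star_mul_self_nonneg y
  have hsa : IsSelfAdjoint q := hq0.isSelfAdjoint
  have hspec : ∀ t ∈ spectrum ℝ q, 0 ≤ t := fun t ht => spectrum_nonneg_of_nonneg hq0 ht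
  have hpos : ∀ t : ℝ, 0 < 1 - t + t * t := fun t => by nlinarith [sq_nonneg (t - 1 / 2)]
  have hc : Continuous fun t : ℝ => t / (1 - t + t * t) :=
    continuous_id.div (by fun_prop) fun t => (hpos t).ne'
  set z := cfc (fun t : ℝ => t / (1 - t + t * t)) q with hz
  have hz0 : 0 ≤ z := cfc_nonneg fun t ht => div_nonneg (hspec t ht) (hpos t).le
  have hu : cfc (fun t : ℝ => 1 - t + t * t) q = 1 - q + q * q := by
    rw [cfc_add q (fun t : ℝ => 1 - t) (fun t : ℝ => t * t),
      cfc_sub (fun _ : ℝ => (1 : ℝ)) (fun t : ℝ => t) q,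
      cfc_mul (fun t : ℝ => t) (fun t : ℝ => t) q, cfc_const_one ℝ q, cfc_id' ℝ q]
  have hzu : z * (1 - q + q * q) = q := by
    rw [← hu, hz, ← cfc_mul _ _ q hc.continuousOn (by fun_prop)]
    conv_rhs => rw [← cfc_id' ℝ q]
    exact cfc_congr fun t _ => div_mul_cancel₀ t (hpos t).ne'
  refine ⟨z, CStarAlgebra.nonneg_iff_eq_star_mul_self.1 hz0, ?_, ?_⟩
  · refine norm_cfc_le zero_le_one fun t ht => ?_
    rw [Real.norm_of_nonneg (div_nonneg (hspec t ht) (hpos t).le), div_le_one (hpos t)]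
    nlinarith [sq_nonneg (t - 1)]
  · have h := congrArg Φ hzu
    rwa [map_mul Φ z, map_add, map_sub, map_one, map_mul Φ q q, hΦq, hpp, sub_add_cancel, mul_one] at h

variable {A : Type*} [CStarAlgebra A] (ω : Ultrafilter ℕ)

/-- For each trace, positivity bounds $\tau(x_i^*x_i)$ by $\tau$ of the whole sum, and
Cauchy-Schwarz bounds that by the 2-norm of the sum. -/
theorem uniformTwoNorm_sq_le {ι : Type*} (s : Finset ι) (x : ι → A) {i : ι} (hi : i ∈ s) :
    uniformTwoNorm A (x i) ≤ √(uniformTwoNorm A (∑ j ∈ s, star (x j) * x j)) := by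
  refine Real.iSup_le (fun τ => Real.sqrt_le_sqrt ?_) (Real.sqrt_nonneg _)
  have hpos : ∀ j, 0 ≤ (τ.1 (star (x j) * x j)).re := fun j =>
    (Complex.nonneg_iff.1 (τ.2.2.1 (x j))).1
  calc (τ.1 (star (x i) * x i)).re ≤ ∑ j ∈ s, (τ.1 (star (x j) * x j)).re :=
        Finset.single_le_sum (f := fun j => (τ.1 (star (x j) * x j)).re) (fun j _ => hpos j) hi
    _ = (τ.1 (∑ j ∈ s, star (x j) * x j)).re := by rw [map_sum, Complex.re_sum]
    _ ≤ ‖τ.1 (∑ j ∈ s, star (x j) * x j)‖ := Complex.re_le_norm _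
    _ ≤ traceNorm τ.1 (∑ j ∈ s, star (x j) * x j) := (traceNorm_props τ.2).2.2 _
    _ ≤ _ := traceNorm_le_iSup subset_rfl _ τ.2

/-- A substitute for positivity in $\mathcal M^\omega$, derived from the traces on $A$ rather than
from a $C^*$-structure on the quotient. -/
theorem seqToBundle_eq_zero_of_sum {ι : Type*} (s : Finset ι) (x : ι → (ℕ →ᵇ A))
    (h : seqToBundle A ω (∑ j ∈ s, star (x j) * x j) = 0) {i : ι} (hi : i ∈ s) :
    seqToBundle A ω (x i) = 0 := by
  rw [seqToBundle_eq_zero_iff, mem_nullIdeal] at h ⊢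
  have h' := h.sqrt
  rw [Real.sqrt_zero] at h'
  refine squeeze_zero (fun n => (uniformTwoNorm A).nonneg _) (fun n => ?_) h'
  refine (uniformTwoNorm_sq_le s (fun j => x j n) hi).trans (le_of_eq ?_)
  rw [BoundedContinuousFunction.coe_sum, Finset.sum_apply]
  rfl

variable {ω} in
/-- Projections in `M^ω` with sum `1` are mutually orthogonal. -/
theorem projections_orthogonal (hω : (ω : Filter ℕ) ≤ cofinite) {ι : Type*} [Fintype ι]
    {p : ι → BundleUltrapower A ω} (hp : ∀ k, IsStarProjection (p k)) (hsum : ∑ k, p k = 1)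
    {k l : ι} (hkl : k ≠ l) : p k * p l = 0 := by
  classical
  choose y hy using fun i => seqToBundle_surjective hω (p i)
  -- The sum in question is $\sum_{i\ne l}(p_ip_l)^*(p_ip_l)=p_l(1-p_l)p_l=0$.
  have h := seqToBundle_eq_zero_of_sum ω (Finset.univ.erase l) (fun i => y i * y l) ?_
    (Finset.mem_erase.2 ⟨hkl, Finset.mem_univ k⟩)
  · rwa [map_mul, hy, hy] at h
  have hpp : ∀ i, p i * p i = p i := fun i => (hp i).isIdempotentElem
  have hterm : ∀ i, seqToBundle A ω (star (y i * y l) * (y i * y l)) = p l * p i * p l := by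
    intro i
    rw [map_mul, map_star, map_mul, hy, hy, star_mul, (hp i).isSelfAdjoint.star_eq,
      (hp l).isSelfAdjoint.star_eq, ← mul_assoc, mul_assoc (p l) (p i) (p i), hpp]
  rw [map_sum]
  simp only [hterm]
  rw [← Finset.sum_mul, ← Finset.mul_sum]
  have hs : ∑ i ∈ Finset.univ.erase l, p i = 1 - p l := by
    rw [← hsum, ← Finset.add_sum_erase _ p (Finset.mem_univ l), add_sub_cancel_left]
  rw [hs, mul_sub, mul_one, hpp, sub_self, zero_mul]

end Lifting

/-! ### Norm-approximate towers -/

section Tower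

variable {R : Type*} [CStarAlgebra R] [PartialOrder R] [StarOrderedRing R]

theorem norm_mul_three_le {a b c : R} {δ : ℝ} (ha : ‖a‖ ≤ 1) (hb : ‖b‖ ≤ δ) (hc : ‖c‖ ≤ 1) :
    ‖a * b * c‖ ≤ δ := by
  have hδ : 0 ≤ δ := (norm_nonneg b).trans hb
  calc ‖a * b * c‖ ≤ ‖a‖ * ‖b‖ * ‖c‖ :=
        (norm_mul_le _ _).trans (mul_le_mul_of_nonneg_right (norm_mul_le _ _) (norm_nonneg _))
    _ ≤ 1 * δ * 1 := by gcongr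
    _ = δ := by ring

theorem norm_mul_le_one {a b : R} (ha : ‖a‖ ≤ 1) (hb : ‖b‖ ≤ 1) : ‖a * b‖ ≤ 1 :=
  (norm_mul_le _ _).trans (mul_le_one₀ ha (norm_nonneg _) hb)

/-- Positive contractions that form a central cyclic tower modulo an invariant ideal can be changed
within their classes into a tower for which the relations hold approximately in norm. -/
theorem exists_approximate_tower (β : R ≃⋆ₐ[ℂ] R) (J : Ideal R) [J.IsTwoSided]
    (hβ : ∀ x, β x ∈ J ↔ x ∈ J) {n : ℕ} [NeZero n] {z : Fin n → R}
    (hz : ∀ k, ∃ b, z k = star b * b) (hz1 : ∀ k, ‖z k‖ ≤ 1) {F : Set R} (hF : F.Finite)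
    (hzF : ∀ k, ∀ a ∈ F, z k * a - a * z k ∈ J) (hzβ : ∀ k, β (z k) - z (k + 1) ∈ J)
    (hzz : ∀ k l, k ≠ l → z k * z l ∈ J) {ε : ℝ} (hε : 0 < ε) :
    ∃ f : Fin n → R, (∀ k, ∃ b, f k = star b * b) ∧ (∀ k, ‖f k‖ ≤ 1) ∧ (∀ k, f k - z k ∈ J) ∧
      (∀ k, ∀ a ∈ F, ‖f k * a - a * f k‖ ≤ ε) ∧ (∀ k, ‖β (f k) - f (k + 1)‖ ≤ ε) ∧
      ∀ k l, k ≠ l → ‖f k * f l‖ ≤ ε := by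
  set S₁ : Set R := ⋃ k, (fun a => z k * a - a * z k) '' F with hS₁
  set S₂ : Set R := Set.range fun k => β (z k) - z (k + 1) with hS₂
  set S₃ : Set R := (fun q : Fin n × Fin n => z q.1 * z q.2) '' {q | q.1 ≠ q.2} with hS₃
  -- `S₁`, `S₂`, `S₃` collect the defects of centrality, cyclicity and orthogonality. The $z_k$ join
  -- `F` because orthogonality requires moving $1-e$ past them. Each relation below splits into
  -- three errors, hence `ε / 3`.
  obtain ⟨e, heJ, he0, he1, heS, heF, heβ⟩ := exists_quasicentral_invariant β J hβ
    (S := S₁ ∪ (S₂ ∪ S₃)) (F := F ∪ Set.range z)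
    ((Set.finite_iUnion fun k => hF.image _).union
      ((Set.finite_range _).union ((Set.toFinite _).image _)))
    (by
      rintro s (hs | ⟨k, rfl⟩ | ⟨q, hq, rfl⟩)
      · simp only [hS₁, Set.mem_iUnion] at hs
        obtain ⟨k, a, ha, rfl⟩ := hs
        exact hzF k a ha
      · exact hzβ k
      · exact hzz _ _ hq)
    (hF.union (Set.finite_range z)) (ε := ε / 3) (by positivity)
  set d := 1 - e with hd
  have hdsa : star d = d := by rw [hd, star_sub, star_one, he0.isSelfAdjoint.star_eq]
  have hd1 : ‖d‖ ≤ 1 := norm_one_sub_le_one he0 he1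
  have hβd1 : ‖β d‖ ≤ 1 := (norm_aut β d).le.trans hd1
  have hdF : ∀ a ∈ F ∪ Set.range z, ‖d * a - a * d‖ ≤ ε / 3 := fun a ha => by
    have h : d * a - a * d = -(e * a - a * e) := by rw [hd]; noncomm_ring
    rw [h, norm_neg]
    exact heF a ha
  have hdβ : ‖β d - d‖ ≤ ε / 3 := by
    have h : β d - d = -(β e - e) := by rw [hd, map_sub, map_one]; abel
    rwa [h, norm_neg]
  have h3 : ∀ {x y w : R}, ‖x‖ ≤ ε / 3 → ‖y‖ ≤ ε / 3 → ‖w‖ ≤ ε / 3 → ‖x + y + w‖ ≤ ε :=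
    fun hx hy hw => (norm_add₃_le).trans (by linarith)
  refine ⟨fun k => d * z k * d, fun k => ?_, fun k => norm_mul_three_le hd1 (hz1 k) hd1,
    fun k => ?_, fun k a ha => ?_, fun k => ?_, fun k l hkl => ?_⟩
  · obtain ⟨b, hb⟩ := hz k
    exact ⟨b * d, by simp only [hb, star_mul, hdsa, mul_assoc]⟩
  · have h : d * z k * d - z k = e * (z k * e) - e * z k - z k * e := by rw [hd]; noncomm_ring
    rw [h]
    exact J.sub_mem (J.sub_mem (J.mul_mem_right _ heJ) (J.mul_mem_right _ heJ))
      (J.mul_mem_left _ heJ)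
  · have h : d * z k * d * a - a * (d * z k * d) = d * z k * (d * a - a * d) * 1 +
        1 * (d * a - a * d) * (z k * d) + 1 * (d * (z k * a - a * z k)) * d := by noncomm_ring
    have h1 : ‖(1 : R)‖ ≤ 1 := norm_le_one_of_nonneg_of_le_one (zero_le_one (α := R)) le_rfl
    simp only
    rw [h]
    refine h3 (norm_mul_three_le (norm_mul_le_one hd1 (hz1 k)) (hdF a (Or.inl ha)) h1)
      (norm_mul_three_le h1 (hdF a (Or.inl ha)) (norm_mul_le_one (hz1 k) hd1))
      (norm_mul_three_le h1 (heS _ (Or.inl ?_)) hd1)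
    exact Set.mem_iUnion.2 ⟨k, a, ha, rfl⟩
  · have h : β (d * z k * d) - d * z (k + 1) * d = 1 * (β d - d) * (β (z k) * β d) +
        d * β (z k) * (β d - d) * 1 + 1 * (d * (β (z k) - z (k + 1))) * d := by
      rw [map_mul, map_mul]; noncomm_ring
    have h1 : ‖(1 : R)‖ ≤ 1 := norm_le_one_of_nonneg_of_le_one (zero_le_one (α := R)) le_rfl
    have hβz : ‖β (z k)‖ ≤ 1 := (norm_aut β _).le.trans (hz1 k)
    simp only
    rw [h]
    exact h3 (norm_mul_three_le h1 hdβ (norm_mul_le_one hβz hβd1))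
      (norm_mul_three_le (norm_mul_le_one hd1 hβz) hdβ h1)
      (norm_mul_three_le h1 (heS _ (Or.inr (Or.inl ⟨k, rfl⟩))) hd1)
  -- Both middle factors $d$ are moved to the left of $z_k$, each at the cost of one commutator, so
  -- that $d$ meets the defect $z_kz_l$.
  · have h : d * z k * d * (d * z l * d) = d * d * (d * (z k * z l)) * d +
        (-(d * d)) * (d * z k - z k * d) * (z l * d) +
        (-d) * (d * z k - z k * d) * (d * z l * d) := by noncomm_ring
    have hcomm := hdF (z k) (Or.inr ⟨k, rfl⟩)
    have hdd := norm_mul_le_one hd1 hd1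
    simp only
    rw [h]
    refine h3 (norm_mul_three_le hdd (heS _ (Or.inr (Or.inr ⟨(k, l), hkl, rfl⟩))) hd1)
      (norm_mul_three_le ((norm_neg _).le.trans hdd) hcomm (norm_mul_le_one (hz1 l) hd1))
      (norm_mul_three_le ((norm_neg _).le.trans hd1) hcomm
        (norm_mul_le_one (norm_mul_le_one hd1 (hz1 l)) hd1))

end Tower

/-! ### From the bundle to the approximate Rokhlin property -/

section Rokhlin

variable {A : Type*} [CStarAlgebra A] {ω : Ultrafilter ℕ}

/-- A Rokhlin tower of projections in `M^ω ∩ M'` yields towers of positive contractions in `A` that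
are central, cyclic and orthogonal up to `ε` in norm and sum up to `1` up to `ε` in the uniform
2-norm. -/
theorem exists_tower_of_projections (hω : (ω : Filter ℕ) ≤ cofinite) (α : A ≃⋆ₐ[ℂ] A) {n : ℕ}
    [NeZero n] {p : Fin n → BundleUltrapower A ω}
    (hp : ∀ k, p k ∈ bundleCentralSeqAlgebra A ω ∧ IsStarProjection (p k))
    (hpα : ∀ k, bundleUltrapowerAut ω α (p k) = p (k + 1)) (hsum : ∑ k, p k = 1) {c : ℝ}
    (hc0 : 0 ≤ c) (hc : bundleUltrapowerTwoNorm A ω (1 - p 0) < c) {F : Set A} (hF : F.Finite)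
    (N : ℕ) {ε : ℝ} (hε : 0 < ε) :
    ∃ a : Fin n → A, (∀ k, ∃ b, a k = star b * b) ∧ (∀ k, ‖a k‖ ≤ 1) ∧
      (∀ k, ∀ x ∈ F, ‖a k * x - x * a k‖ ≤ ε) ∧ (∀ k, ‖α (a k) - a (k + 1)‖ ≤ ε) ∧
      (∀ k l, k ≠ l → ‖a k * a l‖ ≤ ε) ∧ uniformTwoNorm A (1 - ∑ k, a k) ≤ ε ∧
      ∀ m ≤ N, uniformTwoNorm A (1 - a 0 ^ m) ≤ c := by
  let _ := CStarAlgebra.spectralOrder (ℕ →ᵇ A)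
  let _ := CStarAlgebra.spectralOrderedRing (ℕ →ᵇ A)
  set J := nullIdeal (uniformTwoNorm A) (ω : Filter ℕ) with hJ
  choose z hzpos hz1 hzp using fun k =>
    exists_contraction_lift (seqToBundle A ω) (seqToBundle_surjective hω) (hp k).2
  obtain ⟨f, hfpos, hf1, hfz, hfF, hfα, hff⟩ := exists_approximate_tower
    (seqAut α (norm_aut α)) J (fun x => by
      simp only [hJ, mem_nullIdeal, seqAut_apply, uniformTwoNorm_aut]) hzpos hz1
    (hF.image (constSeq A)) (by
      rintro k _ ⟨x, -, rfl⟩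
      rw [← seqToBundle_eq_zero_iff, map_sub, map_mul, map_mul, hzp, seqToBundle_constSeq,
        sub_eq_zero]
      exact (((StarSubalgebra.mem_centralizer_iff ℂ).1 (hp k).1) _ ⟨_, rfl⟩).1.symm)
    (fun k => by
      rw [← seqToBundle_eq_zero_iff, map_sub, seqToBundle_seqAut, hzp, hzp, hpα, sub_self])
    (fun k l hkl => by
      rw [← seqToBundle_eq_zero_iff, map_mul, hzp, hzp]
      exact projections_orthogonal hω (fun k => (hp k).2) hsum hkl) hε
  have hfp : ∀ k, seqToBundle A ω (f k) = p k := fun k =>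
    ((seqToBundle_eq_iff ω _ _).2 (hfz k)).trans (hzp k)
  have hev1 : ∀ᶠ i in (ω : Filter ℕ), uniformTwoNorm A ((1 - ∑ k, f k) i) ≤ ε := by
    have h : 1 - ∑ k, f k ∈ J := by
      rw [← seqToBundle_eq_zero_iff, map_sub, map_one, map_sum]
      simp only [hfp, hsum, sub_self]
    exact ((mem_nullIdeal _).1 h).eventually_le_const hε
  have hev2 : ∀ᶠ i in (ω : Filter ℕ), ∀ m ∈ Finset.range (N + 1),
      uniformTwoNorm A ((1 - f 0 ^ m) i) ≤ c := by
    refine (Finset.eventually_all _).2 fun m _ => ?_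
    -- Only positive powers of $f_0$ lift $p_0$; for $m=0$ the difference vanishes and $0\le c$
    -- suffices.
    rcases m with _ | m
    · refine Eventually.of_forall fun i => ?_
      rw [pow_zero, sub_self]
      exact (uniformTwoNorm A).map_zero.le.trans hc0
    · have h := tendsto_seqToBundle ω (1 - f 0 ^ (m + 1))
      rw [map_sub, map_one, map_pow, hfp, (hp 0).2.isIdempotentElem.pow_succ_eq] at h
      exact h.eventually_le_const hc
  -- The norm estimates hold at every coordinate, since the norm of $\ell^\infty(\mathbb N,A)$ is a
  -- supremum; only the 2-norm estimates restrict $i$ to a set in $\omega$.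
  obtain ⟨i, hi1, hi2⟩ := (hev1.and hev2).exists
  have hnorm : ∀ {x : ℕ →ᵇ A} {r : ℝ}, ‖x‖ ≤ r → ‖x i‖ ≤ r := fun {x} _ hx =>
    (x.norm_coe_le_norm i).trans hx
  refine ⟨fun k => f k i, fun k => ?_, fun k => hnorm (hf1 k),
    fun k x hx => hnorm (hfF k _ ⟨x, hx, rfl⟩), fun k => hnorm (hfα k),
    fun k l hkl => hnorm (hff k l hkl), ?_, fun m hm => ?_⟩
  · obtain ⟨b, hb⟩ := hfpos k
    exact ⟨b i, congrArg (fun x : ℕ →ᵇ A => x i) hb⟩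
  · rwa [BoundedContinuousFunction.sub_apply, BoundedContinuousFunction.coe_sum,
      Finset.sum_apply] at hi1
  · exact hi2 m (Finset.mem_range.2 (Nat.lt_succ_of_le hm))

theorem ultrapowerMk_eq_zero {x : ℕ →ᵇ A} (hx : Tendsto (fun n => ‖x n‖) ω (𝓝 0)) :
    Ultrapower.mk ω x = 0 :=
  Ideal.Quotient.eq_zero_iff_mem.2 hx

theorem ultrapowerTwoNorm_mk_le {x : ℕ →ᵇ A} {c : ℝ}
    (h : ∀ᶠ n in (ω : Filter ℕ), uniformTwoNorm A (x n) ≤ c) :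
    ultrapowerTwoNorm A ω (Ultrapower.mk ω x) ≤ c :=
  le_of_tendsto (tendsto_limSeminorm ω (normSeminorm A) (uniformTwoNorm A)
    (uniformTwoNorm A).le_norm x) h

theorem ultrapowerTwoNorm_mk_eq_zero {x : ℕ →ᵇ A}
    (h : Tendsto (fun n => uniformTwoNorm A (x n)) ω (𝓝 0)) :
    ultrapowerTwoNorm A ω (Ultrapower.mk ω x) = 0 :=
  tendsto_nhds_unique (tendsto_limSeminorm ω (normSeminorm A) (uniformTwoNorm A)
    (uniformTwoNorm A).le_norm x) h

theorem norm_toUltrapower_le (a : A) : ‖toUltrapower A ω a‖ ≤ ‖a‖ :=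
  (norm_mk_le (nullIdeal (normSeminorm A) (ω : Filter ℕ)) _).trans
    ((BoundedContinuousFunction.norm_le (norm_nonneg a)).2 fun _ => le_rfl)

theorem continuous_toUltrapower : Continuous (toUltrapower A ω) :=
  AddMonoidHomClass.continuous_of_bound (toUltrapower A ω) 1 fun a => by
    rw [one_mul]; exact norm_toUltrapower_le a

/-- Reduces centrality to countably many commutation relations, which is what a diagonal sequence
can arrange; this is where separability enters. -/
theorem mem_centralSeqAlgebra_of_dense {d : ℕ → A} (hd : DenseRange d) {f : Ultrapower A ω}
    (h : ∀ i, f * toUltrapower A ω (d i) = toUltrapower A ω (d i) * f) :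
    f ∈ centralSeqAlgebra A ω := by
  have hall : ∀ a, f * toUltrapower A ω a = toUltrapower A ω a * f := fun a =>
    congrFun (hd.equalizer (continuous_const.mul continuous_toUltrapower)
      (continuous_toUltrapower.mul continuous_const) (funext h)) a
  refine (StarSubalgebra.mem_centralizer_iff ℂ).2 ?_
  rintro _ ⟨a, rfl⟩
  refine ⟨(hall a).symm, ?_⟩
  rw [← map_star]
  exact (hall _).symm

theorem approximateRokhlinProperty_of_bundle [TopologicalSpace.SeparableSpace A]
    (hω : (ω : Filter ℕ) ≤ cofinite) (α : A ≃⋆ₐ[ℂ] A) (hα : BundleRokhlinProperty ω α) :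
    ApproximateRokhlinProperty ω α := by
  intro n _
  obtain ⟨p, hp, hpα, hsum, hp0⟩ := hα n
  -- Strict room above $\|1-p_0\|$ turns a limit into an eventual bound, and the maximum with $0$
  -- gives the sign needed for the zeroth power. This $c$ is fixed before the tolerances, hence
  -- uniform in $m$.
  obtain ⟨c, hc, hc1⟩ := exists_between (max_lt zero_lt_one hp0)
  obtain ⟨hc0, hcp⟩ := max_lt_iff.1 hc
  set d := TopologicalSpace.denseSeq A with hd
  -- Diagonal choice: the $r$-th tower has error $1/(r+1)$, almost commutes with the first $r$
  -- points of the dense sequence and controls powers up to $r$. Each fixed point and each fixed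
  -- power is thus covered for all large $r$.
  choose a ha ha1 had haα haa hasum hapow using fun r : ℕ =>
    exists_tower_of_projections hω α hp hpα hsum hc0.le hcp
      ((Set.finite_Iio r).image d) r (Nat.one_div_pos_of_nat (α := ℝ) (n := r))
  choose b hab using ha
  have hat : (ω : Filter ℕ) ≤ atTop := by rwa [← Nat.cofinite_eq_atTop]
  have hlim : Tendsto (fun r : ℕ => 1 / ((r : ℝ) + 1)) ω (𝓝 0) :=
    tendsto_one_div_add_atTop_nhds_zero_nat.mono_left hat
  have hb1 : ∀ r k, ‖b r k‖ ≤ 1 := fun r k => by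
    have h := ha1 r k
    rw [hab, CStarRing.norm_star_mul_self] at h
    nlinarith [norm_nonneg (b r k)]
  let x : Fin n → (ℕ →ᵇ A) := fun k =>
    BoundedContinuousFunction.ofNormedAddCommGroupDiscrete (fun r => a r k) 1 fun r => ha1 r k
  let y : Fin n → (ℕ →ᵇ A) := fun k =>
    BoundedContinuousFunction.ofNormedAddCommGroupDiscrete (fun r => b r k) 1 fun r => hb1 r k
  have hxy : ∀ k, x k = star (y k) * y k := fun k => by ext r; exact hab r k
  have hpos : ∀ k, Ultrapower.mk ω (x k) =
      star (Ultrapower.mk ω (y k)) * Ultrapower.mk ω (y k) := fun k => by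
    rw [hxy, map_mul, map_star]
  have hcentral : ∀ k, Ultrapower.mk ω (x k) ∈ centralSeqAlgebra A ω := fun k => by
    refine mem_centralSeqAlgebra_of_dense (TopologicalSpace.denseRange_denseSeq A) fun i => ?_
    have h : Ultrapower.mk ω (x k * constSeq A (d i) - constSeq A (d i) * x k) = 0 := by
      refine ultrapowerMk_eq_zero (squeeze_zero' (Eventually.of_forall fun _ => norm_nonneg _)
        (((eventually_gt_atTop i).filter_mono hat).mono fun r hr => ?_) hlim)
      exact had r k (d i) ⟨i, hr, rfl⟩
    rwa [map_sub, map_mul, map_mul, sub_eq_zero] at h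
  refine ⟨fun k => Ultrapower.mk ω (x k), fun k => ⟨hcentral k, ⟨_, hpos k⟩, ?_⟩, fun k => ?_,
    fun k l hkl => ?_, ⟨?_, ?_⟩, c, hc1, fun m => ?_⟩
  · exact (norm_mk_le (nullIdeal (normSeminorm A) (ω : Filter ℕ)) (x k)).trans
      ((BoundedContinuousFunction.norm_le zero_le_one).2 fun r => ha1 r k)
  · have h : Ultrapower.mk ω (seqAut α (norm_aut α) (x k) - x (k + 1)) = 0 :=
      ultrapowerMk_eq_zero (squeeze_zero (fun _ => norm_nonneg _) (fun r => haα r k) hlim)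
    rw [map_sub, sub_eq_zero] at h
    exact h
  · have h : Ultrapower.mk ω (x k * x l) = 0 :=
      ultrapowerMk_eq_zero (squeeze_zero (fun _ => norm_nonneg _) (fun r => haa r k l hkl) hlim)
    rwa [map_mul] at h
  · have h : ultrapowerTwoNorm A ω (Ultrapower.mk ω (1 - ∑ k, x k)) = 0 := by
      refine ultrapowerTwoNorm_mk_eq_zero (squeeze_zero (fun _ => (uniformTwoNorm A).nonneg _)
        (fun r => ?_) hlim)
      rw [BoundedContinuousFunction.sub_apply, BoundedContinuousFunction.coe_sum, Finset.sum_apply]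
      exact hasum r
    rwa [map_sub, map_one, map_sum] at h
  · exact sub_mem (one_mem _) (sum_mem fun k _ => hcentral k)
  · have h : ultrapowerTwoNorm A ω (Ultrapower.mk ω (1 - x 0 ^ m)) ≤ c :=
      ultrapowerTwoNorm_mk_le (((eventually_ge_atTop m).filter_mono hat).mono fun r hr =>
        hapow r m hr)
    rwa [map_sub, map_one, map_pow] at h

end Rokhlin

end ApproxRokhlin

end

theorem proposition5 (A : Type*) [CStarAlgebra A] [TopologicalSpace.SeparableSpace A]
    (hT : (ApproxRokhlin.tracialStates A).Nonempty)
    (hK : IsCompact (ApproxRokhlin.extremeTraces A))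
    (ω : Ultrafilter ℕ) (hω : (ω : Filter ℕ) ≤ Filter.cofinite)
    (α : A ≃⋆ₐ[ℂ] A)
    (hα : ApproxRokhlin.BundleRokhlinProperty ω α) :
    ApproxRokhlin.ApproximateRokhlinProperty ω α :=
  ApproxRokhlin.approximateRokhlinProperty_of_bundle hω α hα
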